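/- **Theorem 2.1.** Fix a dimension $m\ge 1$ and a number $k\ge 0$ of auxiliary functions. A *local formula of degree $n$* is a finite sum $$P=\sum e_{\vec\alpha,\vec\beta}(g_{ij})\,(\partial_x^{\alpha_1}g_{i_1j_1})\cdots(\partial_x^{\alpha_a}g_{i_aj_a})\,(\partial_x^{\beta_1}\phi_{\mu_1})\cdots(\partial_x^{\beta_b}\phi_{\mu_b})$$ with $|\alpha_s|>0$, $|\beta_s|\ge 0$ and $|\alpha_1|+\dots+|\alpha_a|+|\beta_1|+\dots+|\beta_b|=n$ in each term, the coefficients $e_{\vec\alpha,\vec\beta}$ being continuous functions of the positive definite matrix $(g_{ij})$. A *local interior invariant* $\mathcal E_n$, homogeneous of degree $n$ in the jets of the metric and of $\phi_1,\dots,\phi_k$, is given by a local formula of degree $n$ whose value does not depend on the choice of local coordinates. A *local boundary invariant* $\mathcal F_{n-1}$, homogeneous of degree $n-1$, is given by a local formula of degree $n-1$, evaluated at boundary points in coordinates with values in a half-space, whose value there does not depend on the choice of such coordinates. There exist constants $\kappa(\mathcal E_n)>0$ for all interior invariants $\mathcal E_n$ ($n\ge 0$) and $\kappa(\mathcal F_{n-1})>0$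 for all boundary invariants $\mathcal F_{n-1}$ ($n\ge 1$), depending only on the invariant, with the following property. Let $M$ be a non-empty compact real analytic manifold of dimension $m$ with (possibly empty) real analytic boundary. Then one can choose, for every real analytic Riemannian metric $g$ and all real analytic functions $\phi_1,\dots,\phi_k$ on $M$, a constant $C=C(M,g,\phi_1,\dots,\phi_k)>0$, independent of $n$, $\mathcal E_n$ and $\mathcal F_{n-1}$, so that for all $\mathcal E_n$ and all $\mathcal F_{n-1}$ $$\Bigl|\int_M \mathcal E_n(x,g,\phi_1,\dots)\,d\mathrm{vol}_m\Bigr|\le \kappa(\mathcal E_n)\,C^n\,\mathrm{vol}_m(M,g),$$ $$\Bigl|\int_{\partial M}\mathcal F_{n-1}(y,g,\phi_1,\dots)\,d\mathrm{vol}_{m-1}\Bigr|\le \kappa(\mathcal F_{n-1})\,C^{n-1}\,\mathrm{vol}_{m-1}(\partial M,g),$$ where an estimate for an invariant of degree $0$ (that is, $\mathcal E_0$ or $\mathcal F_0$) is asserted only if $|\phi_\mu|\le 1$ on $M$ for all $\mu$ (for instance, if $k=0$); and so that, for every $c>0$, $$C(M,c^2g,\phi_1,\dots,\phi_k)=c^{-1}\,C(M,g,\phi_1,\dots,\phi_k).$$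 -/

import Mathlib

open Set MeasureTheory Bundle
open scoped Manifold ContDiff

/-! ### Local formulas in the jets of a metric and of auxiliary functions -/

/-- The jet variables, in dimension `m`, of a metric and of `k` auxiliary functions.
`metric i j I` stands for the partial derivative of **positive** order
`∂_{I 0} ⋯ ∂_{I r} g_{ij}`, and `func μ I` stands for the partial derivative (possibly of order
zero) `∂_{I 0} ⋯ ∂_{I (r-1)} φ_μ`. A multi-index `α` is represented by any list of indices in
which each `i` occurs `α i` times. -/
inductive JetVar (m k : ℕ) : Type
  | metric (i j : Fin m) {r : ℕ} (I : Fin (r + 1) → Fin m) : JetVar m k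
  | func (μ : Fin k) {r : ℕ} (I : Fin r → Fin m) : JetVar m k

/-- The number of differentiations in a jet variable. -/
def JetVar.order {m k : ℕ} : JetVar m k → ℕ
  | @JetVar.metric _ _ _ _ r _ => r + 1
  | @JetVar.func _ _ _ r _ => r

/-- Local formulas: polynomials in the jet variables, the coefficients of which are functions of
the matrix `(g_{ij})`. -/
abbrev LocalFormula (m k : ℕ) : Type :=
  MvPolynomial (JetVar m k) (Matrix (Fin m) (Fin m) ℝ → ℝ)

/-- The partial derivative `∂_{I 0} ⋯ ∂_{I (r-1)} f (x)` of a function on `U`, where `U` is a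
relatively open subset of `ℝ^m` or of a half-space. -/
noncomputable def partialDeriv {m : ℕ} (U : Set (EuclideanSpace ℝ (Fin m)))
    (f : EuclideanSpace ℝ (Fin m) → ℝ) {r : ℕ} (I : Fin r → Fin m)
    (x : EuclideanSpace ℝ (Fin m)) : ℝ :=
  iteratedFDerivWithin ℝ r f U x (fun s => EuclideanSpace.single (I s) (1 : ℝ))

/-- The values at `x` of the jet variables, for a metric `G = (g_{ij})` and functions `φ_μ` given
on `U`. -/
noncomputable def JetVar.value {m k : ℕ} (U : Set (EuclideanSpace ℝ (Fin m)))
    (G : EuclideanSpace ℝ (Fin m) → Matrix (Fin m) (Fin m) ℝ)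
    (φ : Fin k → EuclideanSpace ℝ (Fin m) → ℝ) (x : EuclideanSpace ℝ (Fin m)) :
    JetVar m k → ℝ
  | JetVar.metric i j I => partialDeriv U (fun y => G y i j) I x
  | JetVar.func μ I => partialDeriv U (φ μ) I x

/-- The value at `x` of a local formula, for a metric `G = (g_{ij})` and functions `φ_μ` given on
`U`: the coefficients are evaluated at `(g_{ij}(x))` and the variables at the jets at `x`. -/
noncomputable def LocalFormula.value {m k : ℕ} (P : LocalFormula m k)
    (U : Set (EuclideanSpace ℝ (Fin m)))
    (G : EuclideanSpace ℝ (Fin m) → Matrix (Fin m) (Fin m) ℝ)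
    (φ : Fin k → EuclideanSpace ℝ (Fin m) → ℝ) (x : EuclideanSpace ℝ (Fin m)) : ℝ :=
  MvPolynomial.eval₂ (Pi.evalRingHom (fun _ : Matrix (Fin m) (Fin m) ℝ => ℝ) (G x))
    (JetVar.value U G φ x) P

/-! ### Invariance under changes of coordinates -/

/-- `U` is a relatively open subset of `H`. -/
def IsRelOpen {m : ℕ} (H U : Set (EuclideanSpace ℝ (Fin m))) : Prop :=
  ∃ O : Set (EuclideanSpace ℝ (Fin m)), IsOpen O ∧ U = O ∩ H

/-- `ψ : U → V` is a smooth diffeomorphism, with inverse `χ`, between relatively open subsets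
of `H`. -/
structure IsCoordChange {m : ℕ} (H U V : Set (EuclideanSpace ℝ (Fin m)))
    (ψ χ : EuclideanSpace ℝ (Fin m) → EuclideanSpace ℝ (Fin m)) : Prop where
  relOpen_source : IsRelOpen H U
  relOpen_target : IsRelOpen H V
  mapsTo : MapsTo ψ U V
  mapsTo_inv : MapsTo χ V U
  leftInv : LeftInvOn χ ψ U
  rightInv : RightInvOn χ ψ V
  contDiffOn : ContDiffOn ℝ ∞ ψ U
  contDiffOn_inv : ContDiffOn ℝ ∞ χ V

/-- `G` is a smooth Riemannian metric on `V`. -/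
structure IsLocalMetric {m : ℕ} (V : Set (EuclideanSpace ℝ (Fin m)))
    (G : EuclideanSpace ℝ (Fin m) → Matrix (Fin m) (Fin m) ℝ) : Prop where
  contDiffOn : ∀ i j, ContDiffOn ℝ ∞ (fun y => G y i j) V
  posDef : ∀ y ∈ V, (G y).PosDef

/-- The pulled back metric `(ψ^* G)_{ij} = ∑_{a, b} ∂_i ψ_a ∂_j ψ_b (G_{ab} ∘ ψ)` on `U`. -/
noncomputable def pullbackMetric {m : ℕ} (U : Set (EuclideanSpace ℝ (Fin m)))
    (ψ : EuclideanSpace ℝ (Fin m) → EuclideanSpace ℝ (Fin m))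
    (G : EuclideanSpace ℝ (Fin m) → Matrix (Fin m) (Fin m) ℝ)
    (x : EuclideanSpace ℝ (Fin m)) : Matrix (Fin m) (Fin m) ℝ :=
  Matrix.of fun i j => ∑ a, ∑ b,
    (fderivWithin ℝ ψ U x (EuclideanSpace.single i (1 : ℝ))) a *
      (fderivWithin ℝ ψ U x (EuclideanSpace.single j (1 : ℝ))) b * G (ψ x) a b

/-- The formula `P` is invariant, at the points of `Z`, under all changes of coordinates between
relatively open subsets of `H`. -/
def LocalFormula.IsInvariant {m k : ℕ} (P : LocalFormula m k)
    (H Z : Set (EuclideanSpace ℝ (Fin m))) : Prop :=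
  ∀ (U V : Set (EuclideanSpace ℝ (Fin m)))
    (ψ χ : EuclideanSpace ℝ (Fin m) → EuclideanSpace ℝ (Fin m)), IsCoordChange H U V ψ χ →
  ∀ (G : EuclideanSpace ℝ (Fin m) → Matrix (Fin m) (Fin m) ℝ), IsLocalMetric V G →
  ∀ (φ : Fin k → EuclideanSpace ℝ (Fin m) → ℝ), (∀ μ, ContDiffOn ℝ ∞ (φ μ) V) →
  ∀ x ∈ U ∩ Z,
    P.value U (pullbackMetric U ψ G) (fun μ => φ μ ∘ ψ) x = P.value V G φ (ψ x)

/-- Local interior invariants in dimension `m`, homogeneous of degree `n` in the jets of the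
metric and of `k` auxiliary functions: polynomials in the jets, with coefficients continuous in
`(g_{ij})`, in each monomial of which exactly `n` differentiations occur, and the value of which
does not depend on the coordinates. -/
structure InteriorInvariant (m k n : ℕ) : Type where
  formula : LocalFormula m k
  continuousOn_coeff : ∀ s, ContinuousOn (MvPolynomial.coeff s formula)
    {A : Matrix (Fin m) (Fin m) ℝ | A.PosDef}
  homogeneous : MvPolynomial.IsWeightedHomogeneous JetVar.order formula n
  invariant : formula.IsInvariant univ univ

/-- Local boundary invariants in dimension `m` (the boundary has dimension `m - 1`), homogeneous
of degree `p` in the jets, tangential and normal, of the metric and of `k` auxiliary functions: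
the formula is used at points of the boundary, in coordinates taking values in the half-space
`{x | 0 ≤ x 0}`, and its value there does not depend on the choice of such coordinates. -/
structure BoundaryInvariant (m k p : ℕ) [NeZero m] : Type where
  formula : LocalFormula m k
  continuousOn_coeff : ∀ s, ContinuousOn (MvPolynomial.coeff s formula)
    {A : Matrix (Fin m) (Fin m) ℝ | A.PosDef}
  homogeneous : MvPolynomial.IsWeightedHomogeneous JetVar.order formula p
  invariant : formula.IsInvariant {x | 0 ≤ x 0} {x | x 0 = 0}

/-! ### Real analytic Riemannian manifolds with boundary -/

section Manifold

variable {d : ℕ} {M : Type*} [TopologicalSpace M] [ChartedSpace (EuclideanHalfSpace (d + 1)) M]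

/-- Real analytic Riemannian metrics on a real analytic manifold, possibly with boundary, of
dimension `d + 1`. -/
abbrev AnalyticMetric (d : ℕ) (M : Type*) [TopologicalSpace M]
    [ChartedSpace (EuclideanHalfSpace (d + 1)) M] [IsManifold (𝓡∂ (d + 1)) ω M] : Type _ :=
  ContMDiffRiemannianMetric (𝓡∂ (d + 1)) ω (EuclideanSpace ℝ (Fin (d + 1)))
    (fun x : M => TangentSpace (𝓡∂ (d + 1)) x)

variable [IsManifold (𝓡∂ (d + 1)) ω M]

set_option synthInstance.maxHeartbeats 400000 in
/-- The metric `c² g`. -/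
noncomputable def AnalyticMetric.scale (g : AnalyticMetric d M) (c : ℝ) (hc : 0 < c) :
    AnalyticMetric d M where
  inner x := c ^ 2 • g.inner x
  symm x v w := by
    change c ^ 2 * g.inner x v w = c ^ 2 * g.inner x w v
    rw [g.symm]
  pos x v hv := mul_pos (pow_pos hc 2) (g.pos x v hv)
  isVonNBounded x := by
    refine ((g.isVonNBounded x).image
      (c⁻¹ • ContinuousLinearMap.id ℝ (TangentSpace (𝓡∂ (d + 1)) x))).subset ?_
    intro v hv
    refine ⟨c • v, ?_, ?_⟩
    · have h : c ^ 2 * g.inner x v v < 1 := hv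
      simpa [pow_two, mul_assoc] using h
    · simp [smul_smul, mul_inv_cancel₀ hc.ne']
  contMDiff := g.contMDiff.const_smul_section (a := c ^ 2)

/-- The matrix `(g_{ij})` of the metric in the preferred chart at `x`, as a function on the target
of this chart: `g_{ij} (y) = g (∂_i, ∂_j)` at the point with coordinates `y`. -/
noncomputable def chartMetric (g : AnalyticMetric d M) (x : M)
    (y : EuclideanSpace ℝ (Fin (d + 1))) : Matrix (Fin (d + 1)) (Fin (d + 1)) ℝ :=
  Matrix.of fun i j => g.inner ((extChartAt (𝓡∂ (d + 1)) x).symm y)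
    (mfderivWithin 𝓘(ℝ, EuclideanSpace ℝ (Fin (d + 1))) (𝓡∂ (d + 1))
      (extChartAt (𝓡∂ (d + 1)) x).symm (range (𝓡∂ (d + 1))) y
      (EuclideanSpace.single i (1 : ℝ) : EuclideanSpace ℝ (Fin (d + 1))))
    (mfderivWithin 𝓘(ℝ, EuclideanSpace ℝ (Fin (d + 1))) (𝓡∂ (d + 1))
      (extChartAt (𝓡∂ (d + 1)) x).symm (range (𝓡∂ (d + 1))) y
      (EuclideanSpace.single j (1 : ℝ) : EuclideanSpace ℝ (Fin (d + 1))))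

/-- The value at `x ∈ M` of a local formula. It is computed in the preferred chart at `x`; for an
invariant formula, any other chart gives the same result. -/
noncomputable def LocalFormula.valueAt {k : ℕ} (P : LocalFormula (d + 1) k)
    (g : AnalyticMetric d M) (φ : Fin k → M → ℝ) (x : M) : ℝ :=
  P.value (extChartAt (𝓡∂ (d + 1)) x).target (chartMetric g x)
    (fun μ => φ μ ∘ (extChartAt (𝓡∂ (d + 1)) x).symm) (extChartAt (𝓡∂ (d + 1)) x x)

variable [MeasurableSpace M]

/-- The measure `√(det (g_{ij})) dx` on the domain of the preferred chart at `x`. -/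
noncomputable def chartVolume (g : AnalyticMetric d M) (x : M) : Measure M :=
  Measure.map (extChartAt (𝓡∂ (d + 1)) x).symm
    ((volume.restrict (extChartAt (𝓡∂ (d + 1)) x).target).withDensity
      fun y => ENNReal.ofReal (Real.sqrt (chartMetric g x y).det))

/-- The Riemannian measure `dvol_m` of `(M, g)`, `m = d + 1`. The measures `√(det (g_{ij})) dx` of
any two charts agree on the intersection of their domains, so that the smallest measure which
dominates all of them is the measure which restricts to each of them. -/
noncomputable def riemannianVolume (g : AnalyticMetric d M) : Measure M :=
  ⨆ x : M, chartVolume g x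

/-- The inclusion of `ℝ^d` as the boundary hyperplane `{x | x 0 = 0}` of the half-space of
dimension `d + 1`. -/
noncomputable def boundaryIncl (d : ℕ) (z : EuclideanSpace ℝ (Fin d)) :
    EuclideanSpace ℝ (Fin (d + 1)) :=
  WithLp.toLp 2 (Fin.cons (0 : ℝ) (fun i => z i))

/-- The measure `√(det (g_{ij})_{i, j ≥ 1}) dx_1 ⋯ dx_d` of the restriction of `g` to the boundary,
on the part of the boundary which lies in the domain of the preferred chart at `x`, as a measure
on `M`. -/
noncomputable def chartBoundaryVolume (g : AnalyticMetric d M) (x : M) : Measure M :=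
  Measure.map ((extChartAt (𝓡∂ (d + 1)) x).symm ∘ boundaryIncl d)
    ((volume.restrict (boundaryIncl d ⁻¹' (extChartAt (𝓡∂ (d + 1)) x).target)).withDensity
      fun z => ENNReal.ofReal
        (Real.sqrt ((chartMetric g x (boundaryIncl d z)).submatrix Fin.succ Fin.succ).det))

/-- The Riemannian measure `dvol_{m-1}` of `(∂M, g|_{∂M})`, as a measure on `M` which is
concentrated on `∂M`. If `m = 1`, it counts the points of `∂M`. -/
noncomputable def riemannianBoundaryVolume (g : AnalyticMetric d M) : Measure M :=
  ⨆ x : M, chartBoundaryVolume g x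

end Manifold

open scoped Topology NNReal ENNReal

/-! ### Cauchy estimates -/

/-! An invariant may be evaluated in any coordinates. At each point a linear change of coordinates
makes the metric matrix the identity there (`Matrix.PosDef.exists_normalizing_equiv`), so the
coefficients of the formula become their values at `1`, numbers that depend on the invariant alone.
Only the jets remain to be estimated, and real analyticity gives locally uniform Cauchy bounds `A *
K ^ r * r!` for derivatives of order `r`.

A monomial of weight `n` with `N` factors is then at most `A ^ N * K ^ n` times factorials fixed by
the monomial. The number `N` is not controlled by `n`, since undifferentiated functions `φ_μ` may
occur, but `A ^ N ≤ N! * exp A ≤ N! * (exp A) ^ n` when `n ≥ 1`. With `N!` and the other factorials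
put into `kappa`, the bound reads `kappa * C ^ n` with `C = exp A * K`
(`LocalFormula.abs_value_le`). In weight zero no power of `C` can absorb `A`, whence the assumption
`|φ_μ| ≤ 1`. Compactness of `M` makes `C` uniform (`exists_abs_valueAt_le`), and integration gives
the estimates.

At the boundary the normalizing map must preserve the half-space; a reflection arranges this.
Interior invariants are assumed invariant only on open sets, and invariance at boundary points
follows by continuity (`LocalFormula.isInvariant_halfSpace`). Dilations of coordinates show that an
invariant of weight `n` scales by `c⁻¹ ^ n` under `g ↦ c² g`; hence `C` may be chosen freely on one
metric of each ray and extended by homogeneity (`exists_homogeneous_bound`). Finally, the change of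
variables formula makes the chart measures compatible, so that their suprema are finite on a compact
manifold and the boundary measure lives on the boundary. -/

theorem FormalMultilinearSeries.exists_norm_changeOrigin_le {E F : Type*} [NormedAddCommGroup E]
    [NormedSpace ℝ E] [NormedAddCommGroup F] [NormedSpace ℝ F]
    (p : FormalMultilinearSeries ℝ E F) {ρ : ℝ≥0} (hρ : 0 < ρ) (h : (ρ + ρ : ℝ≥0∞) < p.radius) :
    ∃ A : ℝ≥0, ∀ y : E, ‖y‖₊ ≤ ρ → ∀ n, ‖p.changeOrigin y n‖₊ ≤ A * ρ⁻¹ ^ n := by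
  -- The majorant of the re-expansion of `p` at points of norm `ρ`, evaluated at radius `ρ`, is a
  -- convergent triple sum because `ρ + ρ` is below the radius. Its total value is `A`, and each
  -- degree `n` contributes only a part of it.
  have hs := NNReal.summable_sigma.1 (p.changeOriginSeries_summable_aux₁ h)
  refine ⟨∑' k : ℕ, ∑' s : Σ l : ℕ, { s : Finset (Fin (k + l)) // s.card = l },
    ‖p (k + s.1)‖₊ * ρ ^ s.1 * ρ ^ k, fun y hy n => ?_⟩
  · have hρ' : (ρ : ℝ≥0∞) < p.radius := (le_add_right le_rfl).trans_lt h
    have h1 := p.nnnorm_changeOrigin_le n ((ENNReal.coe_le_coe.2 hy).trans_lt hρ')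
    have h2 := p.changeOriginSeries_summable_aux₂ hρ' n
    have h3 : (∑' s : Σ l : ℕ, { s : Finset (Fin (n + l)) // s.card = l },
        ‖p (n + s.1)‖₊ * ‖y‖₊ ^ s.1) ≤
        ∑' s : Σ l : ℕ, { s : Finset (Fin (n + l)) // s.card = l }, ‖p (n + s.1)‖₊ * ρ ^ s.1 := by
      refine Summable.tsum_le_tsum (fun s => by gcongr) (NNReal.summable_of_le (fun s => ?_) h2) h2
      gcongr
    have h4 := hs.2.le_tsum' n
    rw [inv_pow, ← div_eq_mul_inv, le_div_iff₀ (by positivity)]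
    calc _ ≤ _ := mul_le_mul_left (h1.trans h3) _
      _ = _ := (NNReal.tsum_mul_right _ _).symm
      _ ≤ _ := h4

theorem AnalyticAt.exists_norm_iteratedFDeriv_le {E F : Type*} [NormedAddCommGroup E]
    [NormedSpace ℝ E] [NormedAddCommGroup F] [NormedSpace ℝ F] [CompleteSpace F]
    {f : E → F} {x : E} (hf : AnalyticAt ℝ f x) :
    ∃ A R : ℝ, ∀ᶠ y in 𝓝 x, ∀ n, ‖iteratedFDeriv ℝ n f y‖ ≤ A * R ^ n * n.factorial := by
  obtain ⟨p, r, hp⟩ := hf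
  obtain ⟨ρ, hρ0, hρ⟩ : ∃ ρ : ℝ≥0, 0 < ρ ∧ (ρ + ρ : ℝ≥0∞) < r := by
    obtain ⟨q, hq0, hq⟩ := ENNReal.lt_iff_exists_nnreal_btwn.1 hp.r_pos
    refine ⟨q / 2, by simpa using hq0, ?_⟩
    rw [← ENNReal.coe_add, add_halves]
    exact hq
  obtain ⟨A, hA⟩ := p.exists_norm_changeOrigin_le hρ0 (hρ.trans_le hp.r_le)
  refine ⟨A, (ρ : ℝ)⁻¹, ?_⟩
  filter_upwards [Metric.ball_mem_nhds x (NNReal.coe_pos.2 hρ0)] with y hy n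
  have hy' : ‖y - x‖₊ ≤ ρ := by
    rw [← NNReal.coe_le_coe, coe_nnnorm, ← dist_eq_norm]
    exact (Metric.mem_ball.1 hy).le
  have hq := hp.changeOrigin (y := y - x)
    ((ENNReal.coe_le_coe.2 hy').trans_lt ((le_add_right le_rfl).trans_lt hρ))
  rw [add_sub_cancel] at hq
  have hb : ‖p.changeOrigin (y - x) n‖ ≤ A * (ρ : ℝ)⁻¹ ^ n := by
    exact_mod_cast hA _ hy' n
  refine ContinuousMultilinearMap.opNorm_le_bound (by positivity) fun v => ?_
  -- The derivative is the coefficient at `y` summed over all `n!` permutations of its arguments;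
  -- this is the source of the factorial.
  rw [hq.iteratedFDeriv_eq_sum_of_completeSpace]
  refine (norm_sum_le _ _).trans ?_
  have : ∀ σ ∈ (Finset.univ : Finset (Equiv.Perm (Fin n))),
      ‖p.changeOrigin (y - x) n (fun i => v (σ i))‖ ≤ A * (ρ : ℝ)⁻¹ ^ n * ∏ i, ‖v i‖ := by
    intro σ _
    refine ((p.changeOrigin (y - x) n).le_opNorm _).trans ?_
    rw [Equiv.prod_comp σ (fun i => ‖v i‖)]
    gcongr
  refine (Finset.sum_le_card_nsmul _ _ _ this).trans (le_of_eq ?_)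
  rw [Finset.card_univ, Fintype.card_perm, Fintype.card_fin, nsmul_eq_mul]
  ring

/-- At a boundary point of `s` the function agrees on `s` with one that is analytic in a full
neighbourhood, and unique differentiability identifies the derivatives within `s` with those of the
extension. -/
theorem ContDiffOn.exists_norm_iteratedFDerivWithin_le {E F : Type*} [NormedAddCommGroup E]
    [NormedSpace ℝ E] [NormedAddCommGroup F] [NormedSpace ℝ F] [CompleteSpace F]
    {f : E → F} {s : Set E} (hf : ContDiffOn ℝ ω f s) (hs : UniqueDiffOn ℝ s) {x : E}
    (hx : x ∈ s) :
    ∃ K : ℝ, ∀ᶠ y in 𝓝[s] x, ∀ n, ‖iteratedFDerivWithin ℝ n f s y‖ ≤ K * K ^ n * n.factorial := by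
  obtain ⟨g, hfg, hg⟩ := analyticWithinAt_iff_exists_analyticAt.1
    (contDiffWithinAt_omega_iff_analyticWithinAt.1 (hf x hx))
  rw [insert_eq_of_mem hx] at hfg
  obtain ⟨A, R, hb⟩ := hg.exists_norm_iteratedFDeriv_le
  have hK : ∀ n : ℕ, A * R ^ n * n.factorial ≤ max |A| |R| * max |A| |R| ^ n * n.factorial := by
    intro n
    gcongr ?_ * _
    calc A * R ^ n ≤ |A * R ^ n| := le_abs_self _
      _ = |A| * |R| ^ n := by rw [abs_mul, abs_pow]
      _ ≤ _ := by gcongr <;> simp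
  refine ⟨max |A| |R|, ?_⟩
  have h2 : ∀ᶠ y in 𝓝[s] x, f =ᶠ[𝓝[s] y] g := eventually_eventually_nhdsWithin.2 hfg
  have h3 : ∀ᶠ y in 𝓝[s] x, AnalyticAt ℝ g y := hg.eventually_analyticAt.filter_mono inf_le_left
  filter_upwards [h2, h3, hb.filter_mono inf_le_left, self_mem_nhdsWithin] with y hy1 hy2 hy3 hys n
  rw [hy1.iteratedFDerivWithin_eq (hy1.eq_of_nhdsWithin hys),
    iteratedFDerivWithin_eq_iteratedFDeriv hs hy2.contDiffAt hys]
  exact (hy3 n).trans (hK n)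

/-! ### Normalization of a metric at a point -/

theorem Matrix.PosDef.exists_euclidean_equiv {m : ℕ} {A : Matrix (Fin m) (Fin m) ℝ}
    (hA : A.PosDef) :
    ∃ T : EuclideanSpace ℝ (Fin m) ≃L[ℝ] EuclideanSpace ℝ (Fin m),
      ∀ v w, ∑ a, ∑ b, v a * w b * A a b = inner ℝ (T v) (T w) := by
  obtain ⟨B, hB⟩ : ∃ B : Matrix (Fin m) (Fin m) ℝ, A = B.transpose * B := by
    open scoped MatrixOrder in
    obtain ⟨B, hB⟩ := CStarAlgebra.nonneg_iff_eq_star_mul_self.mp hA.posSemidef.nonneg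
    exact ⟨B, by simpa [Matrix.star_eq_conjTranspose] using hB⟩
  have key : ∀ v w : EuclideanSpace ℝ (Fin m), ∑ a, ∑ b, v a * w b * A a b =
      inner ℝ (Matrix.toEuclideanLin B v) (Matrix.toEuclideanLin B w) := by
    intro v w
    have h1 : ∑ a, ∑ b, v a * w b * A a b = v.ofLp ⬝ᵥ A.mulVec w.ofLp := by
      simp only [dotProduct, Matrix.mulVec, Finset.mul_sum]
      exact Finset.sum_congr rfl fun a _ => Finset.sum_congr rfl fun b _ => by ring
    rw [h1, hB, ← Matrix.mulVec_mulVec, Matrix.dotProduct_mulVec, Matrix.vecMul_transpose,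
      EuclideanSpace.inner_eq_star_dotProduct, dotProduct_comm]
    simp [Matrix.toEuclideanLin]
  have hinj : Function.Injective (Matrix.toEuclideanLin B) := by
    rw [← LinearMap.ker_eq_bot, LinearMap.ker_eq_bot']
    intro v hv
    by_contra h
    have h0 := key v v
    rw [hv, inner_zero_left] at h0
    have h1 := hA.dotProduct_mulVec_pos (x := v.ofLp) (by simpa using h)
    have h2 : ∑ a, ∑ b, v a * v b * A a b = star v.ofLp ⬝ᵥ A.mulVec v.ofLp := by
      simp only [dotProduct, Matrix.mulVec, Finset.mul_sum]
      exact Finset.sum_congr rfl fun a _ => Finset.sum_congr rfl fun b _ => by simp; ring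
    linarith
  exact ⟨(LinearEquiv.ofInjectiveEndo _ hinj).toContinuousLinearEquiv, key⟩

/-- An inverse square root of `A` is determined only up to an orthogonal map on the right. This
freedom is used to make the coordinate `x 0` an eigenfunction with positive factor, so that `L` maps
the half-space and its boundary to themselves and is admissible at boundary points too. -/
theorem Matrix.PosDef.exists_normalizing_equiv {d : ℕ} {A : Matrix (Fin (d + 1)) (Fin (d + 1)) ℝ}
    (hA : A.PosDef) :
    ∃ (L : EuclideanSpace ℝ (Fin (d + 1)) ≃L[ℝ] EuclideanSpace ℝ (Fin (d + 1))) (c : ℝ), 0 < c ∧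
      (∀ x, L x 0 = c * x 0) ∧
      ∀ v w, ∑ a, ∑ b, L v a * L w b * A a b = inner ℝ v w := by
  obtain ⟨T, hT⟩ := hA.exists_euclidean_equiv
  set e : EuclideanSpace ℝ (Fin (d + 1)) := EuclideanSpace.single 0 1 with he
  -- The vector `u` represents the functional `x ↦ (T⁻¹ x) 0`. The reflection `O` below exchanges
  -- `u` and `‖u‖ • e`, so the zeroth coordinate of `T⁻¹ (O x)` is `‖u‖ * x 0`.
  set u := ContinuousLinearMap.adjoint (T.symm : EuclideanSpace ℝ (Fin (d + 1)) →L[ℝ]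
    EuclideanSpace ℝ (Fin (d + 1))) e with hu
  have hue : ∀ x, inner ℝ u x = T.symm x 0 := by
    intro x
    rw [hu, ContinuousLinearMap.adjoint_inner_left, he, EuclideanSpace.inner_single_left]
    simp
  have hu0 : u ≠ 0 := by
    intro h
    have := hue (T e)
    simp [h, he] at this
  have hn : ‖u‖ = ‖‖u‖ • e‖ := by simp [norm_smul, he]
  set O := (ℝ ∙ (u - ‖u‖ • e))ᗮ.reflection with hO
  refine ⟨O.toContinuousLinearEquiv.trans T.symm, ‖u‖, norm_pos_iff.2 hu0, fun x => ?_,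
    fun v w => ?_⟩
  · have h1 : O u = ‖u‖ • e := Submodule.reflection_sub hn
    have h2 : inner ℝ u (O x) = inner ℝ (O u) x := by
      rw [← O.inner_map_map u (O x), hO, Submodule.reflection_reflection]
    rw [ContinuousLinearEquiv.trans_apply]
    change T.symm (O x) 0 = _
    rw [← hue, h2, h1, inner_smul_left, he, EuclideanSpace.inner_single_left]
    simp
  · rw [hT]
    simp

/-! ### Relatively open subsets of the half-space -/

section HalfSpace

variable {d k : ℕ}

/-- The closed half-space of dimension `d + 1`. -/
def halfSpace (d : ℕ) : Set (EuclideanSpace ℝ (Fin (d + 1))) := {x | 0 ≤ x 0}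

theorem range_model_eq_halfSpace : range (𝓡∂ (d + 1)) = halfSpace d :=
  range_modelWithCornersEuclideanHalfSpace (d + 1)

theorem uniqueDiffOn_halfSpace : UniqueDiffOn ℝ (halfSpace d) :=
  range_model_eq_halfSpace (d := d) ▸ (𝓡∂ (d + 1)).uniqueDiffOn

theorem isClosed_halfSpace : IsClosed (halfSpace d) :=
  range_model_eq_halfSpace (d := d) ▸ (𝓡∂ (d + 1)).isClosed_range

theorem isOpen_pos_coord : IsOpen {x : EuclideanSpace ℝ (Fin (d + 1)) | 0 < x 0} :=
  isOpen_lt continuous_const (EuclideanSpace.proj (𝕜 := ℝ) (0 : Fin (d + 1))).continuous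

theorem IsRelOpen.subset {m : ℕ} {H U : Set (EuclideanSpace ℝ (Fin m))} (hU : IsRelOpen H U) :
    U ⊆ H := by
  obtain ⟨O, -, rfl⟩ := hU
  exact inter_subset_right

theorem IsRelOpen.uniqueDiffOn {U : Set (EuclideanSpace ℝ (Fin (d + 1)))}
    (hU : IsRelOpen (halfSpace d) U) : UniqueDiffOn ℝ U := by
  obtain ⟨O, hO, rfl⟩ := hU
  rw [inter_comm]
  exact uniqueDiffOn_halfSpace.inter hO

theorem IsRelOpen.measurableSet {U : Set (EuclideanSpace ℝ (Fin (d + 1)))}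
    (hU : IsRelOpen (halfSpace d) U) : MeasurableSet U := by
  obtain ⟨O, hO, rfl⟩ := hU
  exact hO.measurableSet.inter isClosed_halfSpace.measurableSet

theorem IsRelOpen.mem_nhds {U : Set (EuclideanSpace ℝ (Fin (d + 1)))}
    (hU : IsRelOpen (halfSpace d) U) {x} (hx : x ∈ U) (h0 : 0 < x 0) : U ∈ 𝓝 x := by
  obtain ⟨O, hO, rfl⟩ := hU
  exact Filter.inter_mem (hO.mem_nhds hx.1)
    (Filter.mem_of_superset (isOpen_pos_coord.mem_nhds h0) fun y (hy : 0 < y 0) => hy.le)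

theorem IsRelOpen.isOpen_interior {U : Set (EuclideanSpace ℝ (Fin (d + 1)))}
    (hU : IsRelOpen (halfSpace d) U) : IsOpen (U ∩ {x | 0 < x 0}) :=
  isOpen_iff_mem_nhds.2 fun _ hx =>
    Filter.inter_mem (hU.mem_nhds hx.1 hx.2) (isOpen_pos_coord.mem_nhds hx.2)

theorem IsRelOpen.mem_closure_interior {U : Set (EuclideanSpace ℝ (Fin (d + 1)))}
    (hU : IsRelOpen (halfSpace d) U) {x} (hx : x ∈ U) : x ∈ closure (U ∩ {x | 0 < x 0}) := by
  obtain ⟨O, hO, rfl⟩ := hU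
  -- The point is approached along the inward normal.
  set γ : ℝ → EuclideanSpace ℝ (Fin (d + 1)) := fun t => x + t • EuclideanSpace.single 0 1 with hγ
  have hc : Continuous γ := by fun_prop
  have h0 : γ 0 = x := by simp [hγ]
  have ht : Filter.Tendsto γ (𝓝[>] 0) (𝓝 x) := by
    simpa only [h0] using (hc.tendsto 0).mono_left nhdsWithin_le_nhds
  refine mem_closure_of_tendsto ht ?_
  filter_upwards [ht.eventually (hO.mem_nhds hx.1), self_mem_nhdsWithin] with t ht1 ht2
  have h1 : 0 < γ t 0 := by
    have h2 : (0 : ℝ) ≤ x 0 := hx.2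
    have h3 : (0 : ℝ) < t := ht2
    simp [hγ]
    linarith
  exact ⟨⟨ht1, h1.le⟩, h1⟩

end HalfSpace

/-! ### Jets and values of local formulas -/

section Value

variable {m k : ℕ} {U V : Set (EuclideanSpace ℝ (Fin m))}
  {G G' : EuclideanSpace ℝ (Fin m) → Matrix (Fin m) (Fin m) ℝ}
  {φ φ' : Fin k → EuclideanSpace ℝ (Fin m) → ℝ} {x : EuclideanSpace ℝ (Fin m)}

theorem partialDeriv_congr {f g : EuclideanSpace ℝ (Fin m) → ℝ} (h : EqOn f g U) (hx : x ∈ U)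
    {r : ℕ} (I : Fin r → Fin m) : partialDeriv U f I x = partialDeriv U g I x := by
  rw [partialDeriv, partialDeriv, iteratedFDerivWithin_congr h hx]

theorem partialDeriv_congr_set {f : EuclideanSpace ℝ (Fin m) → ℝ} (h : U =ᶠ[𝓝 x] V)
    {r : ℕ} (I : Fin r → Fin m) : partialDeriv U f I x = partialDeriv V f I x := by
  rw [partialDeriv, partialDeriv, iteratedFDerivWithin_congr_set h]

theorem JetVar.value_metric (i j : Fin m) {r : ℕ} (I : Fin (r + 1) → Fin m) :
    JetVar.value U G φ x (JetVar.metric i j I) = partialDeriv U (fun y => G y i j) I x := rfl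

theorem JetVar.value_func (μ : Fin k) {r : ℕ} (I : Fin r → Fin m) :
    JetVar.value U G φ x (JetVar.func μ I) = partialDeriv U (φ μ) I x := rfl

theorem JetVar.value_congr (hG : EqOn G G' U) (hφ : ∀ μ, EqOn (φ μ) (φ' μ) U) (hx : x ∈ U)
    (v : JetVar m k) : JetVar.value U G φ x v = JetVar.value U G' φ' x v := by
  cases v with
  | metric i j I => exact partialDeriv_congr (fun y hy => by simp only [hG hy]) hx I
  | func μ I => exact partialDeriv_congr (hφ μ) hx I

theorem JetVar.value_congr_set (h : U =ᶠ[𝓝 x] V) (v : JetVar m k) :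
    JetVar.value U G φ x v = JetVar.value V G φ x v := by
  cases v with
  | metric i j I => exact partialDeriv_congr_set h I
  | func μ I => exact partialDeriv_congr_set h I

theorem LocalFormula.value_congr (P : LocalFormula m k) (hG : EqOn G G' U)
    (hφ : ∀ μ, EqOn (φ μ) (φ' μ) U) (hx : x ∈ U) : P.value U G φ x = P.value U G' φ' x := by
  rw [LocalFormula.value, LocalFormula.value, hG hx, funext (JetVar.value_congr hG hφ hx)]

theorem LocalFormula.value_congr_set (P : LocalFormula m k) (h : U =ᶠ[𝓝 x] V) :
    P.value U G φ x = P.value V G φ x := by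
  rw [LocalFormula.value, LocalFormula.value, funext (JetVar.value_congr_set h)]

theorem LocalFormula.value_eq_sum (P : LocalFormula m k) :
    P.value U G φ x = ∑ s ∈ P.support,
      MvPolynomial.coeff s P (G x) * ∏ v ∈ s.support, JetVar.value U G φ x v ^ s v :=
  MvPolynomial.eval₂_eq _ _ _

theorem continuousOn_partialDeriv {f : EuclideanSpace ℝ (Fin m) → ℝ} (hf : ContDiffOn ℝ ∞ f U)
    (hU : UniqueDiffOn ℝ U) {r : ℕ} (I : Fin r → Fin m) :
    ContinuousOn (partialDeriv U f I) U := by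
  have h := hf.continuousOn_iteratedFDerivWithin (m := r) (mod_cast le_top) hU
  exact (ContinuousMultilinearMap.apply ℝ (fun _ : Fin r => EuclideanSpace ℝ (Fin m)) ℝ
    (fun s => EuclideanSpace.single (I s) (1 : ℝ))).continuous.comp_continuousOn h

theorem JetVar.continuousOn_value (hG : IsLocalMetric U G) (hφ : ∀ μ, ContDiffOn ℝ ∞ (φ μ) U)
    (hU : UniqueDiffOn ℝ U) (v : JetVar m k) :
    ContinuousOn (fun x => JetVar.value U G φ x v) U := by
  cases v with
  | metric i j I => exact continuousOn_partialDeriv (hG.contDiffOn i j) hU I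
  | func μ I => exact continuousOn_partialDeriv (hφ μ) hU I

theorem IsLocalMetric.continuousOn (hG : IsLocalMetric U G) : ContinuousOn G U :=
  continuousOn_pi.2 fun i => continuousOn_pi.2 fun j => (hG.contDiffOn i j).continuousOn

theorem LocalFormula.continuousOn_value (P : LocalFormula m k)
    (hP : ∀ s, ContinuousOn (MvPolynomial.coeff s P) {A | A.PosDef}) (hG : IsLocalMetric U G)
    (hφ : ∀ μ, ContDiffOn ℝ ∞ (φ μ) U) (hU : UniqueDiffOn ℝ U) :
    ContinuousOn (P.value U G φ) U := by
  have : P.value U G φ = fun x => ∑ s ∈ P.support,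
      MvPolynomial.coeff s P (G x) * ∏ v ∈ s.support, JetVar.value U G φ x v ^ s v :=
    funext fun x => P.value_eq_sum
  rw [this]
  refine continuousOn_finsetSum _ fun s _ => ContinuousOn.mul ?_ ?_
  · exact (hP s).comp hG.continuousOn fun y hy => hG.posDef y hy
  · exact continuousOn_finsetProd _ fun v _ => (JetVar.continuousOn_value hG hφ hU v).pow _

/-! ### Pulled back metrics -/

/-- The Jacobian matrix of `ψ` on `U`. -/
noncomputable def jacobian {m : ℕ} (U : Set (EuclideanSpace ℝ (Fin m)))
    (ψ : EuclideanSpace ℝ (Fin m) → EuclideanSpace ℝ (Fin m)) (x : EuclideanSpace ℝ (Fin m)) :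
    Matrix (Fin m) (Fin m) ℝ :=
  Matrix.of fun a i => fderivWithin ℝ ψ U x (EuclideanSpace.single i (1 : ℝ)) a

variable {ψ χ : EuclideanSpace ℝ (Fin m) → EuclideanSpace ℝ (Fin m)}

theorem pullbackMetric_eq (x : EuclideanSpace ℝ (Fin m)) :
    pullbackMetric U ψ G x = (jacobian U ψ x).transpose * G (ψ x) * jacobian U ψ x := by
  ext i j
  simp only [pullbackMetric, jacobian, Matrix.of_apply, Matrix.mul_apply, Matrix.transpose_apply,
    Finset.sum_mul]
  rw [Finset.sum_comm]
  exact Finset.sum_congr rfl fun a _ => Finset.sum_congr rfl fun b _ => by ring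

theorem jacobian_eq_toMatrix (x : EuclideanSpace ℝ (Fin m)) :
    jacobian U ψ x = LinearMap.toMatrix (EuclideanSpace.basisFun (Fin m) ℝ).toBasis
      (EuclideanSpace.basisFun (Fin m) ℝ).toBasis (fderivWithin ℝ ψ U x).toLinearMap := by
  ext a i
  simp [jacobian, LinearMap.toMatrix_apply]

theorem det_jacobian (x : EuclideanSpace ℝ (Fin m)) :
    (jacobian U ψ x).det = (fderivWithin ℝ ψ U x).det := by
  rw [jacobian_eq_toMatrix, LinearMap.det_toMatrix, ContinuousLinearMap.det]

theorem pullbackMetric_congr_set (h : U =ᶠ[𝓝 x] V) :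
    pullbackMetric U ψ G x = pullbackMetric V ψ G x := by
  simp only [pullbackMetric, fderivWithin_congr_set h]

/-- By the chain rule `χ ∘ ψ = id` gives a left inverse of the differential; derivatives within `U`
are unique, so this holds at boundary points as well. -/
theorem IsCoordChange.injective_fderivWithin {H : Set (EuclideanSpace ℝ (Fin m))}
    (h : IsCoordChange H U V ψ χ) (hU : UniqueDiffOn ℝ U) (hx : x ∈ U) :
    Function.Injective (fderivWithin ℝ ψ U x) := by
  have h1 := (h.contDiffOn.differentiableOn (by simp) x hx).hasFDerivWithinAt
  have h2 := (h.contDiffOn_inv.differentiableOn (by simp) (ψ x) (h.mapsTo hx)).hasFDerivWithinAt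
  have h3 := (h2.comp x h1 h.mapsTo).congr (f₁ := id) (fun y hy => (h.leftInv hy).symm)
    (h.leftInv hx).symm
  have h4 := (hU x hx).eq h3 (hasFDerivWithinAt_id x U)
  intro v w hvw
  have h5 := congrArg (fun T : EuclideanSpace ℝ (Fin m) →L[ℝ] EuclideanSpace ℝ (Fin m) =>
    T v - T w) h4
  simpa [hvw, sub_eq_zero, eq_comm] using h5

theorem IsCoordChange.isLocalMetric_pullback {H : Set (EuclideanSpace ℝ (Fin m))}
    (h : IsCoordChange H U V ψ χ) (hU : UniqueDiffOn ℝ U) (hG : IsLocalMetric V G) :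
    IsLocalMetric U (pullbackMetric U ψ G) where
  contDiffOn i j := by
    have h1 : ContDiffOn ℝ ∞ (fderivWithin ℝ ψ U) U := h.contDiffOn.fderivWithin hU (by simp)
    have h2 : ∀ i a, ContDiffOn ℝ ∞
        (fun x => fderivWithin ℝ ψ U x (EuclideanSpace.single i (1 : ℝ)) a) U := fun i a =>
      contDiffOn_euclidean.1 (h1.clm_apply contDiffOn_const) a
    simp only [pullbackMetric, Matrix.of_apply]
    exact ContDiffOn.sum fun a _ => ContDiffOn.sum fun b _ =>
      ((h2 i a).mul (h2 j b)).mul ((hG.contDiffOn a b).comp h.contDiffOn h.mapsTo)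
  posDef y hy := by
    rw [pullbackMetric_eq, ← Matrix.conjTranspose_eq_transpose_of_trivial]
    refine (hG.posDef _ (h.mapsTo hy)).conjTranspose_mul_mul_same fun v w hvw => ?_
    have key : ∀ v, (jacobian U ψ y).mulVec v = fderivWithin ℝ ψ U y (WithLp.toLp 2 v) := by
      intro v
      have hv : WithLp.toLp 2 v = ∑ i, v i • EuclideanSpace.single i (1 : ℝ) := by
        ext j
        simp [Finset.sum_apply, Pi.single_apply]
      ext a
      rw [hv, map_sum]
      simp [jacobian, Matrix.mulVec, dotProduct, mul_comm]
    rw [key, key] at hvw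
    exact (WithLp.toLp_injective 2) (h.injective_fderivWithin hU hy (WithLp.ofLp_injective 2 hvw))

/-! ### Linear changes of coordinates -/

theorem partialDeriv_comp_linear (L : EuclideanSpace ℝ (Fin m) ≃L[ℝ] EuclideanSpace ℝ (Fin m))
    (hU : UniqueDiffOn ℝ U) (f : EuclideanSpace ℝ (Fin m) → ℝ) (hx : L x ∈ U) {r : ℕ}
    (I : Fin r → Fin m) : partialDeriv (L ⁻¹' U) (f ∘ L) I x =
      iteratedFDerivWithin ℝ r f U (L x) fun s => L (EuclideanSpace.single (I s) (1 : ℝ)) := by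
  rw [partialDeriv, L.iteratedFDerivWithin_comp_right f hU hx]
  rfl

theorem pullbackMetric_linear (L : EuclideanSpace ℝ (Fin m) ≃L[ℝ] EuclideanSpace ℝ (Fin m))
    (hU : UniqueDiffOn ℝ U) (hx : L x ∈ U) : pullbackMetric (L ⁻¹' U) L G x =
      Matrix.of fun i j => ∑ a, ∑ b, L (EuclideanSpace.single i (1 : ℝ)) a *
        L (EuclideanSpace.single j (1 : ℝ)) b * G (L x) a b := by
  have : fderivWithin ℝ L (L ⁻¹' U) x = L :=
    L.hasFDerivWithinAt.fderivWithin ((L.uniqueDiffOn_preimage_iff).2 hU x hx)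
  simp only [pullbackMetric, this]
  rfl

end Value

/-! ### Invariance in the half-space -/

section Invariance

variable {d k n : ℕ} {U V Z : Set (EuclideanSpace ℝ (Fin (d + 1)))}
  {ψ χ : EuclideanSpace ℝ (Fin (d + 1)) → EuclideanSpace ℝ (Fin (d + 1))}
  {G : EuclideanSpace ℝ (Fin (d + 1)) → Matrix (Fin (d + 1)) (Fin (d + 1)) ℝ}
  {φ : Fin k → EuclideanSpace ℝ (Fin (d + 1)) → ℝ} {x y : EuclideanSpace ℝ (Fin (d + 1))}
  {P : LocalFormula (d + 1) k}

theorem IsCoordChange.symm {H : Set (EuclideanSpace ℝ (Fin (d + 1)))}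
    (h : IsCoordChange H U V ψ χ) : IsCoordChange H V U χ ψ where
  relOpen_source := h.relOpen_target
  relOpen_target := h.relOpen_source
  mapsTo := h.mapsTo_inv
  mapsTo_inv := h.mapsTo
  leftInv := h.rightInv
  rightInv := h.leftInv
  contDiffOn := h.contDiffOn_inv
  contDiffOn_inv := h.contDiffOn

/-- If an interior point went to the boundary, the zeroth component of `ψ` would have a local
minimum there, and its differential would vanish, contrary to the surjectivity of the differential
of `ψ`. -/
theorem IsCoordChange.pos_of_pos (h : IsCoordChange (halfSpace d) U V ψ χ) (hx : x ∈ U)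
    (h0 : 0 < x 0) : 0 < ψ x 0 := by
  refine lt_of_le_of_ne (h.relOpen_target.subset (h.mapsTo hx)) fun h1 => ?_
  have hU := h.relOpen_source.mem_nhds hx h0
  have hψ := (h.contDiffOn.differentiableOn (by simp) x hx).hasFDerivWithinAt
  have hmin : IsLocalMin (fun y => ψ y 0) x := by
    filter_upwards [hU] with y hy
    rw [← h1]
    exact h.relOpen_target.subset (h.mapsTo hy)
  have hd := (EuclideanSpace.proj (𝕜 := ℝ) (0 : Fin (d + 1))).hasFDerivAt.comp x
    (hψ.hasFDerivAt hU)
  have h2 := hmin.hasFDerivAt_eq_zero hd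
  obtain ⟨v, hv⟩ := (LinearMap.injective_iff_surjective
    (f := (fderivWithin ℝ ψ U x).toLinearMap)).1
    (h.injective_fderivWithin h.relOpen_source.uniqueDiffOn hx) (EuclideanSpace.single 0 1)
  have h3 := congrArg (fun T : EuclideanSpace ℝ (Fin (d + 1)) →L[ℝ] ℝ => T v) h2
  have h4 : fderivWithin ℝ ψ U x v = EuclideanSpace.single 0 1 := hv
  simp [h4] at h3

theorem IsCoordChange.coord_eq_zero_iff (h : IsCoordChange (halfSpace d) U V ψ χ) (hx : x ∈ U) :
    ψ x 0 = 0 ↔ x 0 = 0 := by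
  have h1 : 0 ≤ x 0 := h.relOpen_source.subset hx
  have h2 : 0 ≤ ψ x 0 := h.relOpen_target.subset (h.mapsTo hx)
  constructor <;> intro h3 <;> by_contra h4
  · exact (h.pos_of_pos hx (lt_of_le_of_ne h1 (Ne.symm h4))).ne' h3
  · have := h.symm.pos_of_pos (h.mapsTo hx) (lt_of_le_of_ne h2 (Ne.symm h4))
    rw [h.leftInv hx] at this
    exact this.ne' h3

/-- The sets at the points of which invariants are considered: the whole space and the boundary
hyperplane. -/
def IsStratum (Z : Set (EuclideanSpace ℝ (Fin (d + 1)))) : Prop :=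
  Z = univ ∨ Z = {x | x 0 = 0}

theorem IsStratum.mem_iff (hZ : IsStratum Z) (h : x 0 = 0 ↔ y 0 = 0) : x ∈ Z ↔ y ∈ Z := by
  rcases hZ with rfl | rfl
  · simp
  · exact h

theorem IsStratum.mem_iff_of_coordChange (hZ : IsStratum Z)
    (h : IsCoordChange (halfSpace d) U V ψ χ) (hx : x ∈ U) : ψ x ∈ Z ↔ x ∈ Z :=
  hZ.mem_iff (h.coord_eq_zero_iff hx)

theorem IsCoordChange.restrict_interior (h : IsCoordChange (halfSpace d) U V ψ χ) :
    IsCoordChange univ (U ∩ {x | 0 < x 0}) (V ∩ {x | 0 < x 0}) ψ χ where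
  relOpen_source := ⟨_, h.relOpen_source.isOpen_interior, (inter_univ _).symm⟩
  relOpen_target := ⟨_, h.relOpen_target.isOpen_interior, (inter_univ _).symm⟩
  mapsTo _ hy := ⟨h.mapsTo hy.1, h.pos_of_pos hy.1 hy.2⟩
  mapsTo_inv _ hy := ⟨h.mapsTo_inv hy.1, h.symm.pos_of_pos hy.1 hy.2⟩
  leftInv := h.leftInv.mono inter_subset_left
  rightInv := h.rightInv.mono inter_subset_left
  contDiffOn := h.contDiffOn.mono inter_subset_left
  contDiffOn_inv := h.contDiffOn_inv.mono inter_subset_left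

/-- On the open part `0 < x 0` the hypothesis applies directly. Both sides are continuous up to the
boundary, because the coefficients are continuous and the data smooth, and the open part is dense.
-/
theorem LocalFormula.isInvariant_halfSpace (hP : P.IsInvariant univ univ)
    (hc : ∀ s, ContinuousOn (MvPolynomial.coeff s P) {A | A.PosDef}) :
    P.IsInvariant (halfSpace d) univ := by
  intro U V ψ χ h G hG φ hφ x hx
  have hU := h.relOpen_source.uniqueDiffOn
  have hmem : ∀ {W : Set (EuclideanSpace ℝ (Fin (d + 1)))} {y}, y ∈ {x | 0 < x 0} →
      (W ∩ {x | 0 < x 0} : Set (EuclideanSpace ℝ (Fin (d + 1)))) =ᶠ[𝓝 y] W := by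
    intro W y hy
    filter_upwards [isOpen_pos_coord.mem_nhds hy] with z hz
    exact propext ⟨fun h => h.1, fun h => ⟨h, hz⟩⟩
  have key : ∀ y ∈ U ∩ {x | 0 < x 0},
      P.value U (pullbackMetric U ψ G) (fun μ => φ μ ∘ ψ) y = P.value V G φ (ψ y) := by
    intro y hy
    have h1 := hP _ _ ψ χ h.restrict_interior G
      ⟨fun i j => (hG.contDiffOn i j).mono inter_subset_left, fun z hz => hG.posDef z hz.1⟩
      φ (fun μ => (hφ μ).mono inter_subset_left) y ⟨hy, mem_univ y⟩
    rw [P.value_congr_set (hmem (h.pos_of_pos hy.1 hy.2))] at h1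
    rw [← h1, ← P.value_congr_set (hmem hy.2)]
    exact P.value_congr (fun z hz => (pullbackMetric_congr_set (hmem hz.2)).symm)
      (fun μ z hz => rfl) hy
  have h1 := P.continuousOn_value hc (h.isLocalMetric_pullback hU hG)
    (fun μ => (hφ μ).comp h.contDiffOn h.mapsTo) hU
  have h2 := (P.continuousOn_value hc hG hφ h.relOpen_target.uniqueDiffOn).comp
    h.contDiffOn.continuousOn h.mapsTo
  have := mem_closure_iff_nhdsWithin_neBot.1 (h.relOpen_source.mem_closure_interior hx.1)
  refine tendsto_nhds_unique (l := 𝓝[U ∩ {x | 0 < x 0}] x) (((h1 x hx.1).mono inter_subset_left).tendsto)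
    ((((h2 x hx.1).mono inter_subset_left).tendsto).congr' ?_)
  filter_upwards [self_mem_nhdsWithin] with y hy
  exact (key y hy).symm

theorem isCoordChange_linear
    {L : EuclideanSpace ℝ (Fin (d + 1)) ≃L[ℝ] EuclideanSpace ℝ (Fin (d + 1))} {c : ℝ}
    (hc : 0 < c) (hL : ∀ x, L x 0 = c * x 0) (hV : IsRelOpen (halfSpace d) V) :
    IsCoordChange (halfSpace d) (L ⁻¹' V) V L L.symm where
  relOpen_source := by
    obtain ⟨O, hO, rfl⟩ := hV
    refine ⟨L ⁻¹' O, hO.preimage L.continuous, ?_⟩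
    ext x
    have : L x ∈ halfSpace d ↔ x ∈ halfSpace d := by
      change 0 ≤ L x 0 ↔ 0 ≤ x 0
      rw [hL, mul_nonneg_iff_of_pos_left hc]
    simp [this]
  relOpen_target := hV
  mapsTo _ hx := hx
  mapsTo_inv x hx := by simpa using hx
  leftInv x _ := by simp
  rightInv x _ := by simp
  contDiffOn := L.contDiff.contDiffOn
  contDiffOn_inv := L.symm.contDiff.contDiffOn

/-- Under the dilation `x ↦ c • x` the metric pulls back to `c² G`, read at the dilated point, and
each differentiation contributes a further factor `c`. -/
theorem JetVar.value_smul_metric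
    {L : EuclideanSpace ℝ (Fin (d + 1)) ≃L[ℝ] EuclideanSpace ℝ (Fin (d + 1))} {c : ℝ}
    (hL : ∀ x, L x = c • x) (hV : UniqueDiffOn ℝ V) (hx : L x ∈ V) (v : JetVar (d + 1) k) :
    JetVar.value (L ⁻¹' V) (pullbackMetric (L ⁻¹' V) L G) (fun μ => φ μ ∘ L) x v =
      c ^ v.order * JetVar.value V (fun z => c ^ 2 • G z) φ (L x) v := by
  have h3 : ∀ {r : ℕ} (f : EuclideanSpace ℝ (Fin (d + 1)) → ℝ) (I : Fin r → Fin (d + 1)),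
      partialDeriv (L ⁻¹' V) (f ∘ L) I x = c ^ r * partialDeriv V f I (L x) := by
    intro r f I
    rw [partialDeriv_comp_linear L hV f hx]
    simp only [hL]
    rw [ContinuousMultilinearMap.map_smul_univ]
    simp [partialDeriv]
  cases v with
  | metric i j I =>
    rw [JetVar.value_metric, JetVar.value_metric, JetVar.order,
      ← h3 (fun z => (c ^ 2 • G z) i j) I]
    have h4 : EqOn (fun z => pullbackMetric (L ⁻¹' V) L G z i j)
        ((fun z => (c ^ 2 • G z) i j) ∘ L) (L ⁻¹' V) := by
      intro z hz
      simp [pullbackMetric_linear L hV hz, hL, pow_two]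
    exact partialDeriv_congr h4 (mem_preimage.2 hx) I
  | func μ I => rw [JetVar.value_func, JetVar.value_func, JetVar.order, ← h3 (φ μ) I]

/-- The formula applied to the metric pulled back by the dilation equals its value for `G` by
invariance, and `c ^ n` times its value for `c² G` by homogeneity. -/
theorem LocalFormula.value_smul_metric (hP : P.IsInvariant (halfSpace d) Z)
    (hZ : IsStratum Z) (hn : MvPolynomial.IsWeightedHomogeneous JetVar.order P n)
    (hV : IsRelOpen (halfSpace d) V) (hG : IsLocalMetric V G)
    (hφ : ∀ μ, ContDiffOn ℝ ∞ (φ μ) V) (hy : y ∈ V) (hyZ : y ∈ Z) {c : ℝ} (hc : 0 < c) :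
    P.value V (fun z => c ^ 2 • G z) φ y = c⁻¹ ^ n * P.value V G φ y := by
  obtain ⟨L, hL⟩ : ∃ L : EuclideanSpace ℝ (Fin (d + 1)) ≃L[ℝ] EuclideanSpace ℝ (Fin (d + 1)),
      ∀ x, L x = c • x :=
    ⟨(LinearEquiv.smulOfNeZero ℝ _ c hc.ne').toContinuousLinearEquiv, fun x => rfl⟩
  have hL0 : ∀ x, L x 0 = c * x 0 := fun x => by simp [hL]
  obtain ⟨x, rfl⟩ : ∃ x, L x = y := L.surjective y
  have hV' := hV.uniqueDiffOn
  have hxZ : x ∈ Z := (hZ.mem_iff (by rw [hL0]; simp [hc.ne'])).1 hyZ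
  have h1 := hP _ _ L L.symm (isCoordChange_linear hc hL0 hV) G hG φ hφ x ⟨hy, hxZ⟩
  have h2 : pullbackMetric (L ⁻¹' V) L G x = c ^ 2 • G (L x) := by
    rw [pullbackMetric_linear L hV' hy]
    ext i j
    simp [hL, pow_two]
  rw [← h1, LocalFormula.value_eq_sum, LocalFormula.value_eq_sum, Finset.mul_sum]
  refine Finset.sum_congr rfl fun s hs => ?_
  have h5 : ∑ v ∈ s.support, s v * v.order = n := by
    have := hn (MvPolynomial.mem_support_iff.1 hs)
    rwa [Finsupp.weight_apply] at this
  have h6 : ∏ v ∈ s.support, (c ^ v.order) ^ s v = c ^ n := by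
    rw [← h5, ← Finset.prod_pow_eq_pow_sum]
    exact Finset.prod_congr rfl fun v _ => by rw [← pow_mul, mul_comm]
  simp only [JetVar.value_smul_metric hL hV' hy, mul_pow, Finset.prod_mul_distrib, h2, h6]
  rw [mul_left_comm _ (c ^ n), ← mul_assoc, inv_pow, inv_mul_cancel₀ (pow_ne_zero _ hc.ne'),
    one_mul]

/-! ### Estimates for the values of invariants -/

open Classical in
/-- The constant by which the values of an invariant are estimated. -/
noncomputable def LocalFormula.kappa {m k : ℕ} (P : LocalFormula m k) : ℝ :=
  1 + ∑ s ∈ P.support, |MvPolynomial.coeff s P 1| *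
    ((∏ v ∈ s.support, (v.order.factorial : ℝ) ^ s v) *
      ((∑ v ∈ s.support, s v).factorial : ℝ))

theorem LocalFormula.kappa_pos {m k : ℕ} (P : LocalFormula m k) : 0 < P.kappa :=
  add_pos_of_pos_of_nonneg one_pos (Finset.sum_nonneg fun s _ => by positivity)

/-- The metric being normalized at `x`, only coefficients at `1` enter, as in `kappa`. The
factorials in `kappa` account for the factorials of the jet bounds and for `N!`, where `N` is the
number of factors of a monomial; its summand `1` merely ensures positivity. -/
theorem LocalFormula.abs_value_le (hn : MvPolynomial.IsWeightedHomogeneous JetVar.order P n)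
    (hG : G x = 1) {A K : ℝ} (hA : 0 ≤ A) (hK : 0 ≤ K)
    (hv : ∀ v, |JetVar.value U G φ x v| ≤ A * K ^ v.order * v.order.factorial)
    (h0 : n ≠ 0 ∨ ∀ v, v.order = 0 → |JetVar.value U G φ x v| ≤ 1) :
    |P.value U G φ x| ≤ P.kappa * (Real.exp A * K) ^ n := by
  rw [LocalFormula.value_eq_sum, LocalFormula.kappa, hG, add_mul]
  refine (Finset.abs_sum_le_sum_abs _ _).trans (le_add_of_nonneg_of_le (by positivity) ?_)
  rw [Finset.sum_mul]
  refine Finset.sum_le_sum fun s hs => ?_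
  have h5 : ∑ v ∈ s.support, s v * v.order = n := by
    have := hn (MvPolynomial.mem_support_iff.1 hs)
    rwa [Finsupp.weight_apply] at this
  rw [abs_mul, mul_assoc, Finset.abs_prod]
  gcongr _ * ?_
  have hone : ∀ v ∈ s.support, (1 : ℝ) ≤ (v.order.factorial : ℝ) ^ s v := fun v _ =>
    one_le_pow₀ (by exact_mod_cast Nat.one_le_iff_ne_zero.2 v.order.factorial_ne_zero)
  -- In weight zero only undifferentiated functions occur, and these are at most `1`; no bound by
  -- `A` may be used, since `(exp A * K) ^ 0 = 1`.
  rcases eq_or_ne n 0 with rfl | hn0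
  · have h0' := h0.resolve_left (by simp)
    have h6 : ∏ v ∈ s.support, |JetVar.value U G φ x v ^ s v| ≤ 1 := by
      refine Finset.prod_le_one (fun _ _ => abs_nonneg _) fun v hvs => ?_
      have h7 := (Finset.sum_eq_zero_iff.1 h5 v hvs)
      have h8 := (mul_eq_zero.1 h7).resolve_left (Finsupp.mem_support_iff.1 hvs)
      rw [abs_pow]
      exact pow_le_one₀ (abs_nonneg _) (h0' v h8)
    rw [pow_zero, mul_one]
    refine h6.trans (one_le_mul_of_one_le_of_one_le ?_ ?_)
    · exact Finset.prod_induction _ (fun x : ℝ => 1 ≤ x)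
        (fun _ _ => one_le_mul_of_one_le_of_one_le) le_rfl hone
    · exact_mod_cast Nat.one_le_iff_ne_zero.2 (Nat.factorial_ne_zero _)
  · set N := ∑ v ∈ s.support, s v with hN
    have h6 : ∏ v ∈ s.support, |JetVar.value U G φ x v ^ s v| ≤
        A ^ N * K ^ n * ∏ v ∈ s.support, (v.order.factorial : ℝ) ^ s v := by
      rw [hN, ← h5, ← Finset.prod_pow_eq_pow_sum, ← Finset.prod_pow_eq_pow_sum,
        ← Finset.prod_mul_distrib, ← Finset.prod_mul_distrib]
      refine Finset.prod_le_prod (fun _ _ => abs_nonneg _) fun v _ => ?_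
      rw [abs_pow, mul_comm (s v), pow_mul, ← mul_pow, ← mul_pow]
      exact pow_le_pow_left₀ (abs_nonneg _) (hv v) _
    -- The exponential series gives `A ^ N / N! ≤ exp A`, which removes the dependence on the
    -- uncontrolled number `N` of factors; `n ≠ 0` then lets `exp A` be replaced by its `n`-th
    -- power.
    have h7 : A ^ N ≤ N.factorial * Real.exp A ^ n := by
      have h8 := Real.pow_div_factorial_le_exp A hA N
      rw [div_le_iff₀ (by positivity)] at h8
      have h9 : Real.exp A ≤ Real.exp A ^ n := le_self_pow₀ (Real.one_le_exp hA) hn0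
      calc A ^ N ≤ Real.exp A * N.factorial := h8
        _ ≤ Real.exp A ^ n * N.factorial := by gcongr
        _ = _ := mul_comm _ _
    calc _ ≤ _ := h6
      _ ≤ (N.factorial * Real.exp A ^ n) * K ^ n *
          ∏ v ∈ s.support, (v.order.factorial : ℝ) ^ s v := by gcongr
      _ = _ := by rw [mul_pow]; ring

theorem norm_iteratedFDerivWithin_sum_mul_le {E ι : Type*} [NormedAddCommGroup E]
    [NormedSpace ℝ E] (u : Finset ι) (c : ι → ℝ) (f : ι → E → ℝ) {s : Set E}
    (hs : UniqueDiffOn ℝ s) {x : E} (hx : x ∈ s) {r : ℕ} (hf : ∀ i, ContDiffOn ℝ r (f i) s)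
    {b M : ℝ} (hb : 0 ≤ b) (hc : ∀ i, |c i| ≤ b)
    (hM : ∀ i, ‖iteratedFDerivWithin ℝ r (f i) s x‖ ≤ M) :
    ‖iteratedFDerivWithin ℝ r (fun y => ∑ i ∈ u, c i * f i y) s x‖ ≤ u.card * (b * M) := by
  have h1 := iteratedFDerivWithin_fun_sum_apply (𝕜 := ℝ) (u := u) (i := r) (x := x) (s := s)
    (f := fun i => c i • f i) hs hx fun i _ => ((hf i).const_smul (c i)) x hx
  have h2 : (fun y => ∑ i ∈ u, c i * f i y) = fun y => ∑ i ∈ u, (c i • f i) y := by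
    ext y
    simp
  rw [h2, h1, ← nsmul_eq_mul]
  refine (norm_sum_le _ _).trans (Finset.sum_le_card_nsmul _ _ _ fun i _ => ?_)
  rw [iteratedFDerivWithin_const_smul_apply (hf i x hx) hs hx, norm_smul, Real.norm_eq_abs]
  exact mul_le_mul (hc i) (hM i) (norm_nonneg _) hb

theorem abs_partialDeriv_comp_linear_le
    {L : EuclideanSpace ℝ (Fin (d + 1)) ≃L[ℝ] EuclideanSpace ℝ (Fin (d + 1))} {B S : ℝ}
    (hLB : ∀ v, ‖L v‖ ≤ B * ‖v‖) (hV : UniqueDiffOn ℝ V) (hx : L x ∈ V) {r : ℕ}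
    {f : EuclideanSpace ℝ (Fin (d + 1)) → ℝ} (I : Fin r → Fin (d + 1))
    (hS : ‖iteratedFDerivWithin ℝ r f V (L x)‖ ≤ S) :
    |partialDeriv (L ⁻¹' V) (f ∘ L) I x| ≤ S * B ^ r := by
  rw [partialDeriv_comp_linear L hV f hx, ← Real.norm_eq_abs]
  refine (ContinuousMultilinearMap.le_opNorm _ _).trans ?_
  refine mul_le_mul hS ?_ (by positivity) ((norm_nonneg _).trans hS)
  exact (Finset.prod_le_prod (fun _ _ => norm_nonneg _) fun s _ =>
    hLB (EuclideanSpace.single (I s) (1 : ℝ))).trans (by simp)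

/-- An entry of the pulled back metric is a combination of the `(d + 1)²` entries of `G` with
constant coefficients of size at most `B²`, and each differentiation costs a factor `B`. For the
functions the factor `(d + 1)² B² ≥ 1` is superfluous and serves only to give one bound for all
jets. -/
theorem JetVar.abs_value_comp_linear_le
    {L : EuclideanSpace ℝ (Fin (d + 1)) ≃L[ℝ] EuclideanSpace ℝ (Fin (d + 1))} {K B : ℝ}
    (hLB : ∀ v, ‖L v‖ ≤ B * ‖v‖) (hV : UniqueDiffOn ℝ V) (hG : IsLocalMetric V G)
    (hx : L x ∈ V) (hB : 1 ≤ B) (hK : 0 ≤ K)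
    (hGK : ∀ i j r, ‖iteratedFDerivWithin ℝ r (fun z => G z i j) V (L x)‖ ≤
      K * K ^ r * r.factorial)
    (hφK : ∀ μ r, ‖iteratedFDerivWithin ℝ r (φ μ) V (L x)‖ ≤ K * K ^ r * r.factorial)
    (v : JetVar (d + 1) k) :
    |JetVar.value (L ⁻¹' V) (pullbackMetric (L ⁻¹' V) L G) (fun μ => φ μ ∘ L) x v| ≤
      (d + 1) ^ 2 * B ^ 2 * K * (K * B) ^ v.order * v.order.factorial := by
  have hLs : ∀ i a, |L (EuclideanSpace.single i (1 : ℝ)) a| ≤ B := fun i a =>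
    (PiLp.norm_apply_le (L (EuclideanSpace.single i (1 : ℝ))) a).trans
      ((hLB _).trans (by simp))
  cases v with
  | @metric i j r I =>
    set c : Fin (d + 1) × Fin (d + 1) → ℝ := fun p =>
      L (EuclideanSpace.single i (1 : ℝ)) p.1 * L (EuclideanSpace.single j (1 : ℝ)) p.2 with hc
    have h1 := norm_iteratedFDerivWithin_sum_mul_le (r := r + 1) Finset.univ
      c (fun p z => G z p.1 p.2) hV hx
      (fun p => (hG.contDiffOn p.1 p.2).of_le (mod_cast le_top)) (b := B ^ 2) (by positivity)
      (fun p => by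
        rw [abs_mul, pow_two]
        exact mul_le_mul (hLs _ _) (hLs _ _) (abs_nonneg _) (by positivity))
      (fun p => hGK p.1 p.2 (r + 1))
    have h2 : partialDeriv (L ⁻¹' V) (fun z => pullbackMetric (L ⁻¹' V) L G z i j) I x =
        partialDeriv (L ⁻¹' V) ((fun z => ∑ p, c p * G z p.1 p.2) ∘ L) I x := by
      have h3 : EqOn (fun z => pullbackMetric (L ⁻¹' V) L G z i j)
          ((fun z => ∑ p, c p * G z p.1 p.2) ∘ L) (L ⁻¹' V) := by
        intro z hz
        simp only [pullbackMetric_linear L hV hz, Matrix.of_apply, hc, Function.comp_apply,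
          Fintype.sum_prod_type]
      exact partialDeriv_congr h3 (mem_preimage.2 hx) I
    rw [JetVar.value_metric, h2, JetVar.order]
    refine (abs_partialDeriv_comp_linear_le hLB hV hx I h1).trans (le_of_eq ?_)
    rw [Finset.card_univ, Fintype.card_prod, Fintype.card_fin, mul_pow, Nat.cast_mul,
      Nat.cast_add_one]
    ring
  | @func μ r I =>
    have hone : (1 : ℝ) ≤ (d + 1) ^ 2 * B ^ 2 :=
      one_le_mul_of_one_le_of_one_le (one_le_pow₀ (by linarith [d.cast_nonneg (α := ℝ)]))
        (one_le_pow₀ hB)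
    rw [JetVar.value_func, JetVar.order]
    refine (abs_partialDeriv_comp_linear_le hLB hV hx I (hφK μ r)).trans ?_
    rw [mul_pow]
    calc K * K ^ r * r.factorial * B ^ r = 1 * (K * (K ^ r * B ^ r) * r.factorial) := by ring
      _ ≤ ((d + 1) ^ 2 * B ^ 2) * (K * (K ^ r * B ^ r) * r.factorial) := by gcongr
      _ = _ := by ring

theorem LocalFormula.abs_value_le_of_jets_le (hP : P.IsInvariant (halfSpace d) Z)
    (hZ : IsStratum Z) (hn : MvPolynomial.IsWeightedHomogeneous JetVar.order P n)
    (hV : IsRelOpen (halfSpace d) V) (hG : IsLocalMetric V G)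
    (hφ : ∀ μ, ContDiffOn ℝ ∞ (φ μ) V) (hy : y ∈ V) (hyZ : y ∈ Z) {K B : ℝ} (hB : 1 ≤ B)
    (hK : 0 ≤ K)
    (hQ : ∀ v : EuclideanSpace ℝ (Fin (d + 1)), ‖v‖ ^ 2 ≤ B * ∑ a, ∑ b, v a * v b * G y a b)
    (hGK : ∀ i j r, ‖iteratedFDerivWithin ℝ r (fun z => G z i j) V y‖ ≤
      K * K ^ r * r.factorial)
    (hφK : ∀ μ r, ‖iteratedFDerivWithin ℝ r (φ μ) V y‖ ≤ K * K ^ r * r.factorial)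
    (h0 : n ≠ 0 ∨ ∀ μ, |φ μ y| ≤ 1) :
    |P.value V G φ y| ≤ P.kappa * (Real.exp ((d + 1) ^ 2 * B ^ 2 * K) * (K * B)) ^ n := by
  obtain ⟨L, c, hc, hL, hLG⟩ := (hG.posDef y hy).exists_normalizing_equiv
  obtain ⟨x, rfl⟩ : ∃ x, L x = y := L.surjective y
  have hV' := hV.uniqueDiffOn
  have hxZ : x ∈ Z := (hZ.mem_iff (by rw [hL]; simp [hc.ne'])).1 hyZ
  rw [← hP _ _ L L.symm (isCoordChange_linear hc hL hV) G hG φ hφ x ⟨hy, hxZ⟩]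
  -- The map `L` is an isometry from the standard scalar product to `G` at the point, so the lower
  -- bound `hQ` for `G` bounds `L`; since `1 ≤ B`, the natural constant `√B` may be replaced by `B`.
  have hLB : ∀ v, ‖L v‖ ≤ B * ‖v‖ := by
    intro v
    have h1 := hQ (L v)
    rw [hLG, real_inner_self_eq_norm_sq] at h1
    refine abs_le_of_sq_le_sq' ?_ (by positivity) |>.2
    calc ‖L v‖ ^ 2 ≤ B * ‖v‖ ^ 2 := h1
      _ ≤ B ^ 2 * ‖v‖ ^ 2 := by gcongr; exact le_self_pow₀ hB two_ne_zero
      _ = _ := by ring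
  refine LocalFormula.abs_value_le hn ?_ (by positivity) (by positivity)
    (JetVar.abs_value_comp_linear_le hLB hV' hG hy hB hK hGK hφK) ?_
  · rw [pullbackMetric_linear L hV' hy]
    ext i j
    rw [Matrix.of_apply, hLG, EuclideanSpace.inner_single_left]
    simp [Matrix.one_apply]
  · refine h0.imp_right fun h0 v hv => ?_
    cases v with
    | metric i j I => simp [JetVar.order] at hv
    | @func μ r I =>
      rw [JetVar.order] at hv
      subst hv
      rw [JetVar.value_func]
      simpa [partialDeriv] using h0 μ

end Invariance

/-! ### Locally uniform estimates -/

section LocalEstimate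

variable {d k : ℕ} {V : Set (EuclideanSpace ℝ (Fin (d + 1)))}
  {G : EuclideanSpace ℝ (Fin (d + 1)) → Matrix (Fin (d + 1)) (Fin (d + 1)) ℝ}
  {φ : Fin k → EuclideanSpace ℝ (Fin (d + 1)) → ℝ} {p : EuclideanSpace ℝ (Fin (d + 1))}

theorem exists_eventually_norm_iteratedFDerivWithin_le {E ι : Type*} [NormedAddCommGroup E]
    [NormedSpace ℝ E] [Finite ι] {f : ι → E → ℝ} {s : Set E} (hf : ∀ i, ContDiffOn ℝ ω (f i) s)
    (hs : UniqueDiffOn ℝ s) {x : E} (hx : x ∈ s) :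
    ∃ K : ℝ, 0 < K ∧ ∀ᶠ y in 𝓝[s] x, ∀ i r,
      ‖iteratedFDerivWithin ℝ r (f i) s y‖ ≤ K * K ^ r * r.factorial := by
  have := Fintype.ofFinite ι
  choose K hK using fun i => (hf i).exists_norm_iteratedFDerivWithin_le hs hx
  have h0 : 0 ≤ ∑ i, |K i| := Finset.sum_nonneg fun i _ => abs_nonneg _
  refine ⟨1 + ∑ i, |K i|, by linarith, ?_⟩
  filter_upwards [Filter.eventually_all.2 hK] with y hy i r
  have h1 : |K i| ≤ 1 + ∑ i, |K i| :=
    (Finset.single_le_sum (f := fun i => |K i|) (fun i _ => abs_nonneg _)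
      (Finset.mem_univ i)).trans (by linarith)
  refine (hy i r).trans ?_
  gcongr ?_ * _
  calc K i * K i ^ r ≤ |K i * K i ^ r| := le_abs_self _
    _ = |K i| * |K i| ^ r := by rw [abs_mul, abs_pow]
    _ ≤ _ := by gcongr

/-- A lower bound for the quadratic form of `A` survives small perturbations with twice the
constant. -/
theorem Matrix.PosDef.eventually_norm_sq_le {m : ℕ} {X : Type*} {l : Filter X}
    {G : X → Matrix (Fin m) (Fin m) ℝ} {A : Matrix (Fin m) (Fin m) ℝ} (hA : A.PosDef)
    (hG : Filter.Tendsto G l (𝓝 A)) :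
    ∃ B : ℝ, 1 ≤ B ∧ ∀ᶠ y in l, ∀ v : EuclideanSpace ℝ (Fin m),
      ‖v‖ ^ 2 ≤ B * ∑ a, ∑ b, v a * v b * G y a b := by
  obtain ⟨T, hT⟩ := hA.exists_euclidean_equiv
  set N : ℝ := ‖(T.symm : EuclideanSpace ℝ (Fin m) →L[ℝ] EuclideanSpace ℝ (Fin m))‖ ^ 2 + 1
    with hN
  have hN1 : 1 ≤ N := by simp [hN]
  have h1 : ∀ v : EuclideanSpace ℝ (Fin m), ‖v‖ ^ 2 ≤ N * ∑ a, ∑ b, v a * v b * A a b := by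
    intro v
    rw [hT, real_inner_self_eq_norm_sq]
    have h2 := (T.symm : EuclideanSpace ℝ (Fin m) →L[ℝ] EuclideanSpace ℝ (Fin m)).le_opNorm (T v)
    simp only [ContinuousLinearEquiv.coe_coe, ContinuousLinearEquiv.symm_apply_apply] at h2
    have h3 := pow_le_pow_left₀ (norm_nonneg v) h2 2
    nlinarith [sq_nonneg ‖T v‖]
  -- With this `ε` the perturbation of the form, multiplied by `N`, is at most half of `‖v‖²` and is
  -- absorbed on the left.
  obtain ⟨ε, hε0, hε⟩ : ∃ ε : ℝ, 0 < ε ∧ N * (m ^ 2 * ε) ≤ 1 / 2 := by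
    refine ⟨1 / (2 * N * (m ^ 2 + 1)), by positivity, ?_⟩
    rw [mul_one_div, mul_div_assoc', div_le_iff₀ (by positivity)]
    nlinarith
  have h2 : ∀ᶠ y in l, ∀ a b, |G y a b - A a b| < ε := by
    refine Filter.eventually_all.2 fun a => Filter.eventually_all.2 fun b => ?_
    have h3 : Filter.Tendsto (fun y => G y a b) l (𝓝 (A a b)) :=
      ((continuous_apply_apply a b).tendsto A).comp hG
    exact (Metric.tendsto_nhds.1 h3) ε hε0
  refine ⟨2 * N, by linarith, ?_⟩
  filter_upwards [h2] with y hy v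
  have h4 : |∑ a, ∑ b, v a * v b * (G y a b - A a b)| ≤ m ^ 2 * ε * ‖v‖ ^ 2 := by
    calc |∑ a, ∑ b, v a * v b * (G y a b - A a b)|
        ≤ ∑ a : Fin m, ∑ b : Fin m, ‖v‖ * ‖v‖ * ε := by
          refine (Finset.abs_sum_le_sum_abs _ _).trans (Finset.sum_le_sum fun a _ => ?_)
          refine (Finset.abs_sum_le_sum_abs _ _).trans (Finset.sum_le_sum fun b _ => ?_)
          rw [abs_mul, abs_mul]
          gcongr
          · exact PiLp.norm_apply_le v a
          · exact PiLp.norm_apply_le v b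
          · exact (hy a b).le
      _ = _ := by simp; ring
  have h5 : ∑ a, ∑ b, v a * v b * A a b =
      ∑ a, ∑ b, v a * v b * G y a b - ∑ a, ∑ b, v a * v b * (G y a b - A a b) := by
    simp only [← Finset.sum_sub_distrib]
    exact Finset.sum_congr rfl fun a _ => Finset.sum_congr rfl fun b _ => by ring
  have h6 := h1 v
  rw [h5] at h6
  have h7 : N * (-∑ a, ∑ b, v a * v b * (G y a b - A a b)) ≤ N * (m ^ 2 * ε * ‖v‖ ^ 2) :=
    mul_le_mul_of_nonneg_left ((neg_le_abs _).trans h4) (by linarith)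
  have h8 : N * (m ^ 2 * ε * ‖v‖ ^ 2) ≤ 1 / 2 * ‖v‖ ^ 2 := by
    rw [← mul_assoc]
    gcongr
  linarith

/-- The essential point is the order of quantifiers: `C` and the neighbourhood come from the metric
and the functions alone and serve all strata, weights and formulas at once. -/
theorem exists_eventually_abs_value_le (hV : IsRelOpen (halfSpace d) V)
    (hG : ∀ i j, ContDiffOn ℝ ω (fun y => G y i j) V) (hpos : ∀ y ∈ V, (G y).PosDef)
    (hφ : ∀ μ, ContDiffOn ℝ ω (φ μ) V) (hp : p ∈ V) :
    ∃ C : ℝ, 0 < C ∧ ∀ᶠ y in 𝓝[V] p, ∀ (Z : Set (EuclideanSpace ℝ (Fin (d + 1)))) (n : ℕ)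
      (P : LocalFormula (d + 1) k), IsStratum Z → P.IsInvariant (halfSpace d) Z →
      MvPolynomial.IsWeightedHomogeneous JetVar.order P n → y ∈ Z →
      (n ≠ 0 ∨ ∀ μ, |φ μ y| ≤ 1) → |P.value V G φ y| ≤ P.kappa * C ^ n := by
  have hV' := hV.uniqueDiffOn
  have hGm : IsLocalMetric V G := ⟨fun i j => (hG i j).of_le le_top, hpos⟩
  obtain ⟨K, hK0, hK⟩ := exists_eventually_norm_iteratedFDerivWithin_le
    (f := Sum.elim (fun (q : Fin (d + 1) × Fin (d + 1)) z => G z q.1 q.2) φ)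
    (by rintro (q | μ); exacts [hG q.1 q.2, hφ μ]) hV' hp
  obtain ⟨B, hB1, hB⟩ := (hpos p hp).eventually_norm_sq_le (hGm.continuousOn p hp)
  refine ⟨Real.exp ((d + 1) ^ 2 * B ^ 2 * K) * (K * B), by positivity, ?_⟩
  filter_upwards [hK, hB, self_mem_nhdsWithin] with y hyK hyB hyV Z n P hZ hP hn hyZ h0
  exact LocalFormula.abs_value_le_of_jets_le hP hZ hn hV hGm
    (fun μ => (hφ μ).of_le le_top) hyV hyZ hB1 hK0.le hyB
    (fun i j r => hyK (Sum.inl (i, j)) r) (fun μ r => hyK (Sum.inr μ) r) h0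

end LocalEstimate

/-! ### Charts -/

section Charts

variable {d k : ℕ} {M : Type*} [TopologicalSpace M]
  [ChartedSpace (EuclideanHalfSpace (d + 1)) M]

theorem isRelOpen_extChartAt_preimage (p : M) {O : Set M} (hO : IsOpen O) :
    IsRelOpen (halfSpace d) ((extChartAt (𝓡∂ (d + 1)) p).target ∩
      (extChartAt (𝓡∂ (d + 1)) p).symm ⁻¹' O) := by
  obtain ⟨u, hu, hu'⟩ := (continuousOn_iff'.1 (continuousOn_extChartAt_symm (I := 𝓡∂ (d + 1)) p))
    O hO
  refine ⟨u ∩ (𝓡∂ (d + 1)).symm ⁻¹' (chartAt (EuclideanHalfSpace (d + 1)) p).target,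
    hu.inter ((chartAt _ p).open_target.preimage (𝓡∂ (d + 1)).continuous_symm), ?_⟩
  rw [inter_comm, hu', extChartAt_target, range_model_eq_halfSpace, inter_assoc]

theorem isRelOpen_extChartAt_target (p : M) :
    IsRelOpen (halfSpace d) (extChartAt (𝓡∂ (d + 1)) p).target := by
  simpa using isRelOpen_extChartAt_preimage p isOpen_univ

/-- The domain of the change of coordinates between the preferred charts at `p` and `q`. -/
def overlap (d : ℕ) {M : Type*} [TopologicalSpace M]
    [ChartedSpace (EuclideanHalfSpace (d + 1)) M] (p q : M) :
    Set (EuclideanSpace ℝ (Fin (d + 1))) :=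
  (extChartAt (𝓡∂ (d + 1)) p).target ∩
    (extChartAt (𝓡∂ (d + 1)) p).symm ⁻¹' (extChartAt (𝓡∂ (d + 1)) q).source

/-- The change of coordinates between the preferred charts at `p` and `q`. -/
noncomputable def transition (d : ℕ) {M : Type*} [TopologicalSpace M]
    [ChartedSpace (EuclideanHalfSpace (d + 1)) M] (p q : M) :
    EuclideanSpace ℝ (Fin (d + 1)) → EuclideanSpace ℝ (Fin (d + 1)) :=
  extChartAt (𝓡∂ (d + 1)) q ∘ (extChartAt (𝓡∂ (d + 1)) p).symm

theorem isRelOpen_overlap (p q : M) : IsRelOpen (halfSpace d) (overlap d p q) :=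
  isRelOpen_extChartAt_preimage p (isOpen_extChartAt_source q)

theorem mapsTo_transition (p q : M) : MapsTo (transition d p q) (overlap d p q) (overlap d q p) :=
  fun y hy => ⟨(extChartAt (𝓡∂ (d + 1)) q).map_source hy.2, by
    rw [mem_preimage, transition, Function.comp_apply, (extChartAt (𝓡∂ (d + 1)) q).left_inv hy.2]
    exact (extChartAt (𝓡∂ (d + 1)) p).map_target hy.1⟩

theorem extChartAt_symm_transition {p q : M} {y : EuclideanSpace ℝ (Fin (d + 1))}
    (hy : y ∈ overlap d p q) :
    (extChartAt (𝓡∂ (d + 1)) q).symm (transition d p q y) =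
      (extChartAt (𝓡∂ (d + 1)) p).symm y :=
  (extChartAt (𝓡∂ (d + 1)) q).left_inv hy.2

theorem leftInvOn_transition (p q : M) :
    LeftInvOn (transition d q p) (transition d p q) (overlap d p q) := by
  intro y hy
  rw [transition, Function.comp_apply, extChartAt_symm_transition hy]
  exact (extChartAt (𝓡∂ (d + 1)) p).right_inv hy.1

variable [IsManifold (𝓡∂ (d + 1)) ω M]

theorem isCoordChange_transition (p q : M) :
    IsCoordChange (halfSpace d) (overlap d p q) (overlap d q p)
      (transition d p q) (transition d q p) where
  relOpen_source := isRelOpen_overlap p q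
  relOpen_target := isRelOpen_overlap q p
  mapsTo := mapsTo_transition p q
  mapsTo_inv := mapsTo_transition q p
  leftInv := leftInvOn_transition p q
  rightInv := leftInvOn_transition q p
  contDiffOn := (contDiffOn_ext_coord_change (n := ω) q p).of_le le_top
  contDiffOn_inv := (contDiffOn_ext_coord_change (n := ω) p q).of_le le_top

/-- The differential of the inverse of the preferred chart at `p`, which sends `∂_i` to the
corresponding tangent vector of `M`. -/
noncomputable def chartFrame (d : ℕ) {M : Type*} [TopologicalSpace M]
    [ChartedSpace (EuclideanHalfSpace (d + 1)) M] (p : M) (y : EuclideanSpace ℝ (Fin (d + 1))) :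
    EuclideanSpace ℝ (Fin (d + 1)) →L[ℝ] EuclideanSpace ℝ (Fin (d + 1)) :=
  mfderivWithin 𝓘(ℝ, EuclideanSpace ℝ (Fin (d + 1))) (𝓡∂ (d + 1))
    (extChartAt (𝓡∂ (d + 1)) p).symm (range (𝓡∂ (d + 1))) y

/-- The scalar product of the metric `g` at `x`, on the model space. -/
noncomputable def AnalyticMetric.form (g : AnalyticMetric d M) (x : M) :
    EuclideanSpace ℝ (Fin (d + 1)) →L[ℝ] EuclideanSpace ℝ (Fin (d + 1)) →L[ℝ] ℝ :=
  g.inner x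

theorem chartMetric_apply (g : AnalyticMetric d M) (p : M) (y : EuclideanSpace ℝ (Fin (d + 1)))
    (i j : Fin (d + 1)) :
    chartMetric g p y i j = g.form ((extChartAt (𝓡∂ (d + 1)) p).symm y)
      (chartFrame d p y (EuclideanSpace.single i 1))
      (chartFrame d p y (EuclideanSpace.single j 1)) := rfl

theorem AnalyticMetric.form_sum_sum (g : AnalyticMetric d M) (x : M) {ι : Type*} (u : Finset ι)
    (a b : ι → ℝ) (v w : ι → EuclideanSpace ℝ (Fin (d + 1))) :
    g.form x (∑ i ∈ u, a i • v i) (∑ j ∈ u, b j • w j) =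
      ∑ i ∈ u, ∑ j ∈ u, a i * b j * g.form x (v i) (w j) := by
  simp only [map_sum, map_smul, _root_.sum_apply, _root_.smul_apply,
    smul_eq_mul, Finset.mul_sum, mul_assoc]
  rw [Finset.sum_comm]
  exact Finset.sum_congr rfl fun i _ => Finset.sum_congr rfl fun j _ => by ring

theorem AnalyticMetric.form_comm (g : AnalyticMetric d M) (x : M)
    (v w : EuclideanSpace ℝ (Fin (d + 1))) : g.form x v w = g.form x w v := g.symm x v w

theorem AnalyticMetric.form_self_pos (g : AnalyticMetric d M) (x : M)
    {v : EuclideanSpace ℝ (Fin (d + 1))} (hv : v ≠ 0) : 0 < g.form x v v := g.pos x v hv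

theorem chartFrame_injective (p : M) {y : EuclideanSpace ℝ (Fin (d + 1))}
    (hy : y ∈ (extChartAt (𝓡∂ (d + 1)) p).target) : Function.Injective (chartFrame d p y) := by
  have : IsManifold (𝓡∂ (d + 1)) 1 M := IsManifold.of_le (n := ω) le_top
  exact (isInvertible_mfderivWithin_extChartAt_symm hy).injective

theorem EuclideanSpace.eq_sum_single {m : ℕ} (v : EuclideanSpace ℝ (Fin m)) :
    v = ∑ i, v i • EuclideanSpace.single i (1 : ℝ) := by
  ext j
  simp [Finset.sum_apply, Pi.single_apply]

theorem AnalyticMetric.form_map_map (g : AnalyticMetric d M) (x : M)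
    (T : EuclideanSpace ℝ (Fin (d + 1)) →L[ℝ] EuclideanSpace ℝ (Fin (d + 1)))
    (v w : EuclideanSpace ℝ (Fin (d + 1))) :
    g.form x (T v) (T w) = ∑ a, ∑ b, v a * w b *
      g.form x (T (EuclideanSpace.single a 1)) (T (EuclideanSpace.single b 1)) := by
  have h : ∀ v, T v = ∑ a, v a • T (EuclideanSpace.single a 1) := by
    intro v
    conv_lhs => rw [EuclideanSpace.eq_sum_single v]
    simp only [map_sum, map_smul]
  rw [h v, h w, g.form_sum_sum]

theorem posDef_chartMetric (g : AnalyticMetric d M) (p : M)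
    {y : EuclideanSpace ℝ (Fin (d + 1))} (hy : y ∈ (extChartAt (𝓡∂ (d + 1)) p).target) :
    (chartMetric g p y).PosDef := by
  refine Matrix.PosDef.of_dotProduct_mulVec_pos ?_ fun x hx => ?_
  · ext i j
    simp only [Matrix.conjTranspose_apply, star_trivial, chartMetric_apply]
    exact g.form_comm _ _ _
  · have h0 : chartFrame d p y (WithLp.toLp 2 x) ≠ 0 := by
      rw [Ne, map_eq_zero_iff _ (chartFrame_injective p hy)]
      simpa using hx
    have h1 := g.form_self_pos ((extChartAt (𝓡∂ (d + 1)) p).symm y) h0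
    rw [g.form_map_map] at h1
    refine h1.trans_le (le_of_eq ?_)
    simp only [dotProduct, Matrix.mulVec, Finset.mul_sum, chartMetric_apply, star_trivial]
    exact Finset.sum_congr rfl fun a _ => Finset.sum_congr rfl fun b _ => by ring

/-- The chain rule for the inverse chart at `p`, which on the overlap factors through the chart at
`q`. Derivatives within the overlap and within the range of the model agree, as the two sets
coincide near `y`. -/
theorem chartFrame_transition {p q : M} {y : EuclideanSpace ℝ (Fin (d + 1))}
    (hy : y ∈ overlap d p q) : chartFrame d p y =
      (chartFrame d q (transition d p q y)).comp
        (fderivWithin ℝ (transition d p q) (overlap d p q) y) := by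
  have : IsManifold (𝓡∂ (d + 1)) 1 M := IsManifold.of_le (n := ω) le_top
  have h := isCoordChange_transition (d := d) p q
  have hU := h.relOpen_source.uniqueDiffOn
  have hmem : overlap d p q =ᶠ[𝓝 y] range (𝓡∂ (d + 1)) := by
    obtain ⟨O, hO, hO'⟩ := isRelOpen_overlap (d := d) p q
    rw [hO', range_model_eq_halfSpace]
    filter_upwards [hO.mem_nhds (hO' ▸ hy).1] with z hz
    exact propext ⟨fun h => h.2, fun h => ⟨hz, h⟩⟩
  have h1 : MDifferentiableWithinAt 𝓘(ℝ, EuclideanSpace ℝ (Fin (d + 1))) (𝓡∂ (d + 1))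
      (extChartAt (𝓡∂ (d + 1)) q).symm (range (𝓡∂ (d + 1))) (transition d p q y) :=
    mdifferentiableWithinAt_extChartAt_symm (h.mapsTo hy).1
  have h2 := (h.contDiffOn.differentiableOn (by simp) y hy).mdifferentiableWithinAt
  have h3 := mfderivWithin_comp y h1 h2
    (fun z hz => extChartAt_target_subset_range q (h.mapsTo hz).1)
    (hU y hy).uniqueMDiffWithinAt
  rw [mfderivWithin_eq_fderivWithin] at h3
  have h4 : chartFrame d p y = (mfderivWithin 𝓘(ℝ, EuclideanSpace ℝ (Fin (d + 1))) (𝓡∂ (d + 1))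
      ((extChartAt (𝓡∂ (d + 1)) q).symm ∘ transition d p q) (overlap d p q) y :
      EuclideanSpace ℝ (Fin (d + 1)) →L[ℝ] EuclideanSpace ℝ (Fin (d + 1))) := by
    rw [chartFrame, ← mfderivWithin_congr_set hmem]
    exact (mfderivWithin_congr (fun z hz => extChartAt_symm_transition hz)
      (extChartAt_symm_transition hy)).symm
  rw [h4]
  exact h3

theorem chartMetric_eq_pullback (g : AnalyticMetric d M) {p q : M}
    {y : EuclideanSpace ℝ (Fin (d + 1))} (hy : y ∈ overlap d p q) :
    chartMetric g p y = pullbackMetric (overlap d p q) (transition d p q) (chartMetric g q) y := by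
  ext i j
  rw [chartMetric_apply, chartFrame_transition hy, ContinuousLinearMap.comp_apply,
    ContinuousLinearMap.comp_apply, g.form_map_map]
  simp only [pullbackMetric, Matrix.of_apply, chartMetric_apply, extChartAt_symm_transition hy]

/-- The coordinate fields of the chart at `p` are the constant sections of the tangent bundle in its
trivialization at `p`. These are analytic, and so is the metric applied to two of them. -/
theorem contDiffOn_chartMetric (g : AnalyticMetric d M) (p : M) (i j : Fin (d + 1)) :
    ContDiffOn ℝ ω (fun y => chartMetric g p y i j) (extChartAt (𝓡∂ (d + 1)) p).target := by
  have : IsManifold (𝓡∂ (d + 1)) 1 M := IsManifold.of_le (n := ω) le_top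
  set E := EuclideanSpace ℝ (Fin (d + 1)) with hE
  set e := trivializationAt E (TangentSpace (𝓡∂ (d + 1)) : M → Type _) p with he
  have hs : ∀ i : Fin (d + 1), ContMDiffOn (𝓡∂ (d + 1)) ((𝓡∂ (d + 1)).prod 𝓘(ℝ, E)) ω
      (fun m : M => TotalSpace.mk' E (E := (TangentSpace (𝓡∂ (d + 1)) : M → Type _)) m
        (e.symmL ℝ m (EuclideanSpace.single i 1))) (extChartAt (𝓡∂ (d + 1)) p).source := by
    intro i x hx
    rw [extChartAt_source] at hx
    have hx' : x ∈ e.baseSet := by simpa [he] using hx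
    rw [e.contMDiffWithinAt_section _ hx']
    refine contMDiffWithinAt_const (c := EuclideanSpace.single i 1) |>.congr_of_eventuallyEq ?_ ?_
    · filter_upwards [mem_nhdsWithin_of_mem_nhds (e.open_baseSet.mem_nhds hx')] with z hz
      rw [e.symmL_apply hz, e.apply_mk_symm hz]
    · rw [e.symmL_apply hx', e.apply_mk_symm hx']
  have h1 : ContMDiffOn (𝓡∂ (d + 1)) 𝓘(ℝ, ℝ) ω
      (fun m : M => g.inner m (e.symmL ℝ m (EuclideanSpace.single i 1))
        (e.symmL ℝ m (EuclideanSpace.single j 1))) (extChartAt (𝓡∂ (d + 1)) p).source := by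
    intro x hx
    have : ContMDiffWithinAt (𝓡∂ (d + 1)) ((𝓡∂ (d + 1)).prod 𝓘(ℝ, ℝ)) ω
        (fun m ↦ TotalSpace.mk' ℝ (E := Bundle.Trivial M ℝ) m
          (g.inner m (e.symmL ℝ m (EuclideanSpace.single i 1))
        (e.symmL ℝ m (EuclideanSpace.single j 1)))) (extChartAt (𝓡∂ (d + 1)) p).source x := by
      apply ContMDiffWithinAt.clm_bundle_apply₂ (F₁ := E) (F₂ := E)
      · exact g.contMDiff.contMDiffAt.contMDiffWithinAt
      · exact hs i x hx
      · exact hs j x hx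
    simp only [contMDiffWithinAt_totalSpace] at this
    exact this.2
  rw [← contMDiffOn_iff_contDiffOn]
  refine (h1.comp (contMDiffOn_extChartAt_symm p)
    (extChartAt (𝓡∂ (d + 1)) p).mapsTo_symm).congr fun y hy => ?_
  have hy' := (extChartAt (𝓡∂ (d + 1)) p).map_target hy
  have h2 := TangentBundle.symmL_trivializationAt (I := 𝓡∂ (d + 1))
    (by rwa [extChartAt_source] at hy')
  rw [(extChartAt (𝓡∂ (d + 1)) p).right_inv hy] at h2
  rw [chartMetric_apply, Function.comp_apply, h2]
  rfl

theorem isLocalMetric_chartMetric (g : AnalyticMetric d M) (p : M) :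
    IsLocalMetric (extChartAt (𝓡∂ (d + 1)) p).target (chartMetric g p) :=
  ⟨fun i j => (contDiffOn_chartMetric g p i j).of_le le_top,
    fun _ hy => posDef_chartMetric g p hy⟩

end Charts

/-! ### Values of invariants on a manifold -/

section ValueAt

variable {d k : ℕ} {M : Type*} [TopologicalSpace M]
  [ChartedSpace (EuclideanHalfSpace (d + 1)) M] {Z : Set (EuclideanSpace ℝ (Fin (d + 1)))}
  {P : LocalFormula (d + 1) k} {φ : Fin k → M → ℝ} {n : ℕ}

theorem IsRelOpen.eventuallyEq_halfSpace {U : Set (EuclideanSpace ℝ (Fin (d + 1)))}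
    (hU : IsRelOpen (halfSpace d) U) {x} (hx : x ∈ U) : U =ᶠ[𝓝 x] halfSpace d := by
  obtain ⟨O, hO, rfl⟩ := hU
  filter_upwards [hO.mem_nhds hx.1] with z hz
  exact propext ⟨fun h => h.2, fun h => ⟨hz, h⟩⟩

theorem overlap_eventuallyEq {p q : M} {y : EuclideanSpace ℝ (Fin (d + 1))}
    (hy : y ∈ overlap d p q) : overlap d p q =ᶠ[𝓝 y] (extChartAt (𝓡∂ (d + 1)) p).target :=
  ((isRelOpen_overlap p q).eventuallyEq_halfSpace hy).trans
    ((isRelOpen_extChartAt_target p).eventuallyEq_halfSpace hy.1).symm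

theorem extChartAt_mem_overlap {p q x : M} (hp : x ∈ (extChartAt (𝓡∂ (d + 1)) p).source)
    (hq : x ∈ (extChartAt (𝓡∂ (d + 1)) q).source) :
    extChartAt (𝓡∂ (d + 1)) p x ∈ overlap d p q :=
  ⟨(extChartAt (𝓡∂ (d + 1)) p).map_source hp, by
    rwa [mem_preimage, (extChartAt (𝓡∂ (d + 1)) p).left_inv hp]⟩

theorem transition_extChartAt {p q x : M} (hp : x ∈ (extChartAt (𝓡∂ (d + 1)) p).source) :
    transition d p q (extChartAt (𝓡∂ (d + 1)) p x) = extChartAt (𝓡∂ (d + 1)) q x := by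
  rw [transition, Function.comp_apply, (extChartAt (𝓡∂ (d + 1)) p).left_inv hp]

/-- The points of `M` which correspond to points of `Z` in the charts. -/
def stratumIn (M : Type*) [TopologicalSpace M] [ChartedSpace (EuclideanHalfSpace (d + 1)) M]
    (Z : Set (EuclideanSpace ℝ (Fin (d + 1)))) : Set M :=
  {q | extChartAt (𝓡∂ (d + 1)) q q ∈ Z}

variable [IsManifold (𝓡∂ (d + 1)) ω M]

theorem IsStratum.mem_stratumIn_iff (hZ : IsStratum Z) {p q : M}
    (hq : q ∈ (extChartAt (𝓡∂ (d + 1)) p).source) :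
    q ∈ stratumIn M Z ↔ extChartAt (𝓡∂ (d + 1)) p q ∈ Z := by
  have h := hZ.mem_iff_of_coordChange (isCoordChange_transition p q)
    (extChartAt_mem_overlap hq (mem_extChartAt_source q))
  rw [transition_extChartAt hq] at h
  exact h

theorem IsStratum.isClosed_stratumIn (hZ : IsStratum Z) : IsClosed (stratumIn M Z) := by
  have hc : IsClosed Z := by
    rcases hZ with rfl | rfl
    · exact isClosed_univ
    · exact isClosed_eq (EuclideanSpace.proj (𝕜 := ℝ) (0 : Fin (d + 1))).continuous
        continuous_const
  rw [← isOpen_compl_iff, isOpen_iff_mem_nhds]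
  intro q hq
  filter_upwards [extChartAt_source_mem_nhds (I := 𝓡∂ (d + 1)) q,
    (continuousAt_extChartAt (I := 𝓡∂ (d + 1)) q).preimage_mem_nhds (hc.isOpen_compl.mem_nhds hq)]
    with x hx1 hx2
  rw [mem_compl_iff, hZ.mem_stratumIn_iff hx1]
  exact hx2

theorem contDiffOn_comp_extChartAt_symm {f : M → ℝ} (hf : ContMDiff (𝓡∂ (d + 1)) 𝓘(ℝ, ℝ) ω f)
    (p : M) : ContDiffOn ℝ ω (f ∘ (extChartAt (𝓡∂ (d + 1)) p).symm)
      (extChartAt (𝓡∂ (d + 1)) p).target :=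
  contMDiffOn_iff_contDiffOn.1 (hf.comp_contMDiffOn (contMDiffOn_extChartAt_symm p))

/-- `valueAt` uses a different chart at each point. Invariance allows a whole neighbourhood to be
treated in the single chart at `p`, as both the continuity and the uniform bounds require. -/
theorem LocalFormula.valueAt_eq (hP : P.IsInvariant (halfSpace d) Z)
    (g : AnalyticMetric d M) (hφ : ∀ μ, ContMDiff (𝓡∂ (d + 1)) 𝓘(ℝ, ℝ) ω (φ μ)) {p q : M}
    (hq : q ∈ (extChartAt (𝓡∂ (d + 1)) p).source) (hqZ : q ∈ stratumIn M Z) :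
    P.valueAt g φ q = P.value (extChartAt (𝓡∂ (d + 1)) p).target (chartMetric g p)
      (fun μ => φ μ ∘ (extChartAt (𝓡∂ (d + 1)) p).symm) (extChartAt (𝓡∂ (d + 1)) p q) := by
  have hy := extChartAt_mem_overlap (mem_extChartAt_source (I := 𝓡∂ (d + 1)) q) hq
  have hy' := extChartAt_mem_overlap hq (mem_extChartAt_source (I := 𝓡∂ (d + 1)) q)
  have hsub : overlap d p q ⊆ (extChartAt (𝓡∂ (d + 1)) p).target := inter_subset_left
  have h1 := hP _ _ _ _ (isCoordChange_transition q p) (chartMetric g p)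
    ⟨fun i j => ((isLocalMetric_chartMetric g p).contDiffOn i j).mono hsub,
      fun y hy => (isLocalMetric_chartMetric g p).posDef y (hsub hy)⟩
    (fun μ => φ μ ∘ (extChartAt (𝓡∂ (d + 1)) p).symm)
    (fun μ => ((contDiffOn_comp_extChartAt_symm (hφ μ) p).of_le le_top).mono hsub) _ ⟨hy, hqZ⟩
  rw [transition_extChartAt (mem_extChartAt_source q),
    P.value_congr_set (overlap_eventuallyEq hy')] at h1
  rw [← h1, LocalFormula.valueAt, ← P.value_congr_set (overlap_eventuallyEq hy)]
  refine P.value_congr (fun z hz => chartMetric_eq_pullback g hz) (fun μ z hz => ?_) hy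
  simp only [Function.comp_apply, extChartAt_symm_transition hz]

theorem LocalFormula.continuousOn_valueAt (hP : P.IsInvariant (halfSpace d) Z)
    (hc : ∀ s, ContinuousOn (MvPolynomial.coeff s P) {A | A.PosDef})
    (g : AnalyticMetric d M) (hφ : ∀ μ, ContMDiff (𝓡∂ (d + 1)) 𝓘(ℝ, ℝ) ω (φ μ)) :
    ContinuousOn (P.valueAt g φ) (stratumIn M Z) := by
  intro p hp
  have h1 := P.continuousOn_value hc (isLocalMetric_chartMetric g p)
    (fun μ => (contDiffOn_comp_extChartAt_symm (hφ μ) p).of_le le_top)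
    (isRelOpen_extChartAt_target p).uniqueDiffOn
  have h2 := h1.comp (continuousOn_extChartAt (I := 𝓡∂ (d + 1)) p)
    (extChartAt (𝓡∂ (d + 1)) p).mapsTo
  have h3 := (h2.continuousAt (extChartAt_source_mem_nhds p)).continuousWithinAt
    (s := stratumIn M Z)
  refine h3.congr_of_eventuallyEq ?_
    (LocalFormula.valueAt_eq hP g hφ (mem_extChartAt_source p) hp)
  filter_upwards [self_mem_nhdsWithin, mem_nhdsWithin_of_mem_nhds
    (extChartAt_source_mem_nhds (I := 𝓡∂ (d + 1)) p)] with q hq1 hq2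
  exact LocalFormula.valueAt_eq hP g hφ hq2 hq1

theorem exists_abs_valueAt_le [CompactSpace M] (g : AnalyticMetric d M)
    (hφ : ∀ μ, ContMDiff (𝓡∂ (d + 1)) 𝓘(ℝ, ℝ) ω (φ μ)) :
    ∃ C : ℝ, 0 < C ∧ ∀ (Z : Set (EuclideanSpace ℝ (Fin (d + 1)))) (n : ℕ)
      (P : LocalFormula (d + 1) k), IsStratum Z → P.IsInvariant (halfSpace d) Z →
      MvPolynomial.IsWeightedHomogeneous JetVar.order P n →
      (n ≠ 0 ∨ ∀ μ x, |φ μ x| ≤ 1) → ∀ q ∈ stratumIn M Z,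
      |P.valueAt g φ q| ≤ P.kappa * C ^ n := by
  have key : ∃ C : ℝ, 0 < C ∧ ∀ q ∈ (univ : Set M), ∀ (Z : Set (EuclideanSpace ℝ (Fin (d + 1))))
      (n : ℕ) (P : LocalFormula (d + 1) k), IsStratum Z → P.IsInvariant (halfSpace d) Z →
      MvPolynomial.IsWeightedHomogeneous JetVar.order P n →
      (n ≠ 0 ∨ ∀ μ x, |φ μ x| ≤ 1) → q ∈ stratumIn M Z →
      |P.valueAt g φ q| ≤ P.kappa * C ^ n := by
    -- Compactness: the local constants are combined by `max`, which is harmless because `kappa` is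
    -- positive and the bound increases with `C`.
    refine isCompact_univ.induction_on (p := fun S : Set M => ∃ C : ℝ, 0 < C ∧ ∀ q ∈ S,
      ∀ (Z : Set (EuclideanSpace ℝ (Fin (d + 1))))
      (n : ℕ) (P : LocalFormula (d + 1) k), IsStratum Z → P.IsInvariant (halfSpace d) Z →
      MvPolynomial.IsWeightedHomogeneous JetVar.order P n →
      (n ≠ 0 ∨ ∀ μ x, |φ μ x| ≤ 1) → q ∈ stratumIn M Z →
      |P.valueAt g φ q| ≤ P.kappa * C ^ n) ⟨1, one_pos, by simp⟩ ?_ ?_ ?_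
    · rintro S T hST ⟨C, hC0, hC⟩
      exact ⟨C, hC0, fun q hq => hC q (hST hq)⟩
    · rintro S T ⟨C, hC0, hC⟩ ⟨C', hC0', hC'⟩
      refine ⟨max C C', lt_max_of_lt_left hC0, fun q hq Z n P h1 h2 h3 h4 h5 => ?_⟩
      have hκ := P.kappa_pos.le
      rcases hq with hq | hq
      · refine (hC q hq Z n P h1 h2 h3 h4 h5).trans ?_
        gcongr
        exact le_max_left _ _
      · refine (hC' q hq Z n P h1 h2 h3 h4 h5).trans ?_
        gcongr
        exact le_max_right _ _
    · intro p _
      obtain ⟨C, hC0, hC⟩ := exists_eventually_abs_value_le (isRelOpen_extChartAt_target p)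
        (contDiffOn_chartMetric g p) (fun y hy => posDef_chartMetric g p hy)
        (fun μ => contDiffOn_comp_extChartAt_symm (hφ μ) p)
        ((extChartAt (𝓡∂ (d + 1)) p).map_source (mem_extChartAt_source p))
      have ht : Filter.Tendsto (extChartAt (𝓡∂ (d + 1)) p) (𝓝 p)
          (𝓝[(extChartAt (𝓡∂ (d + 1)) p).target] (extChartAt (𝓡∂ (d + 1)) p p)) :=
        tendsto_nhdsWithin_iff.2 ⟨continuousAt_extChartAt p,
          Filter.mem_of_superset (extChartAt_source_mem_nhds p)
            (extChartAt (𝓡∂ (d + 1)) p).mapsTo⟩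
      have h1 := (ht.eventually hC).and (extChartAt_source_mem_nhds (I := 𝓡∂ (d + 1)) p)
      refine ⟨_, mem_nhdsWithin_of_mem_nhds h1, C, hC0, ?_⟩
      rintro q ⟨hq1, hq2⟩ Z n P hZ hP hn h0 hqZ
      rw [LocalFormula.valueAt_eq hP g hφ hq2 hqZ]
      exact hq1 Z n P hZ hP hn ((hZ.mem_stratumIn_iff hq2).1 hqZ)
        (h0.imp_right fun h μ => h μ _)
  obtain ⟨C, hC0, hC⟩ := key
  exact ⟨C, hC0, fun Z n P h1 h2 h3 h4 q hq => hC q (mem_univ q) Z n P h1 h2 h3 h4 hq⟩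

/-! ### Rescaling -/

theorem AnalyticMetric.ext_inner {g h : AnalyticMetric d M} (H : g.inner = h.inner) : g = h := by
  cases g
  cases h
  cases H
  rfl

theorem AnalyticMetric.scale_scale (g : AnalyticMetric d M) {a b c : ℝ} (ha : 0 < a)
    (hb : 0 < b) (hc : 0 < c) (h : b * a = c) : (g.scale a ha).scale b hb = g.scale c hc := by
  refine AnalyticMetric.ext_inner (funext fun x => ?_)
  change b ^ 2 • a ^ 2 • g.inner x = c ^ 2 • g.inner x
  rw [smul_smul, ← mul_pow, h]

theorem AnalyticMetric.scale_one (g : AnalyticMetric d M) : g.scale 1 one_pos = g := by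
  refine AnalyticMetric.ext_inner (funext fun x => ?_)
  change (1 : ℝ) ^ 2 • g.inner x = g.inner x
  rw [one_pow, one_smul]

theorem AnalyticMetric.form_scale (g : AnalyticMetric d M) {c : ℝ} (hc : 0 < c) (x : M)
    (v w : EuclideanSpace ℝ (Fin (d + 1))) :
    (g.scale c hc).form x v w = c ^ 2 * g.form x v w := rfl

theorem chartMetric_scale (g : AnalyticMetric d M) {c : ℝ} (hc : 0 < c) (p : M) :
    chartMetric (g.scale c hc) p = fun y => c ^ 2 • chartMetric g p y := by
  ext y i j
  rw [Matrix.smul_apply, chartMetric_apply, chartMetric_apply, g.form_scale, smul_eq_mul]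

theorem LocalFormula.valueAt_scale (hP : P.IsInvariant (halfSpace d) Z) (hZ : IsStratum Z)
    (hn : MvPolynomial.IsWeightedHomogeneous JetVar.order P n) (g : AnalyticMetric d M)
    (hφ : ∀ μ, ContMDiff (𝓡∂ (d + 1)) 𝓘(ℝ, ℝ) ω (φ μ)) {c : ℝ} (hc : 0 < c) {q : M}
    (hq : q ∈ stratumIn M Z) :
    P.valueAt (g.scale c hc) φ q = c⁻¹ ^ n * P.valueAt g φ q := by
  rw [LocalFormula.valueAt, chartMetric_scale, LocalFormula.valueAt]
  exact LocalFormula.value_smul_metric hP hZ hn (isRelOpen_extChartAt_target q)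
    (isLocalMetric_chartMetric g q)
    (fun μ => (contDiffOn_comp_extChartAt_symm (hφ μ) q).of_le le_top)
    ((extChartAt (𝓡∂ (d + 1)) q).map_source (mem_extChartAt_source q)) hq hc

variable [Nonempty M]

/-- The length, with respect to `g`, of a fixed tangent vector. -/
noncomputable def AnalyticMetric.gauge (g : AnalyticMetric d M) : ℝ :=
  Real.sqrt (g.form (Classical.arbitrary M) (EuclideanSpace.single 0 1)
    (EuclideanSpace.single 0 1))

theorem AnalyticMetric.gauge_pos (g : AnalyticMetric d M) : 0 < g.gauge :=
  Real.sqrt_pos.2 (g.form_self_pos _ (by simp))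

theorem AnalyticMetric.gauge_scale (g : AnalyticMetric d M) {c : ℝ} (hc : 0 < c) :
    (g.scale c hc).gauge = c * g.gauge := by
  rw [AnalyticMetric.gauge, g.form_scale, Real.sqrt_mul (sq_nonneg c), Real.sqrt_sq hc.le,
    AnalyticMetric.gauge]

theorem exists_homogeneous_bound (d k : ℕ) (M : Type*) [TopologicalSpace M] [CompactSpace M]
    [Nonempty M] [ChartedSpace (EuclideanHalfSpace (d + 1)) M] [IsManifold (𝓡∂ (d + 1)) ω M] :
    ∃ C : AnalyticMetric d M → (Fin k → M → ℝ) → ℝ, ∀ (g : AnalyticMetric d M)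
      (φ : Fin k → M → ℝ), (∀ μ, ContMDiff (𝓡∂ (d + 1)) 𝓘(ℝ, ℝ) ω (φ μ)) → 0 < C g φ ∧
      (∀ (Z : Set (EuclideanSpace ℝ (Fin (d + 1)))) (n : ℕ)
        (P : LocalFormula (d + 1) k), IsStratum Z → P.IsInvariant (halfSpace d) Z →
        MvPolynomial.IsWeightedHomogeneous JetVar.order P n →
        (n ≠ 0 ∨ ∀ μ x, |φ μ x| ≤ 1) → ∀ q ∈ stratumIn M Z,
        |P.valueAt g φ q| ≤ P.kappa * C g φ ^ n) ∧
      ∀ (c : ℝ) (hc : 0 < c), C (g.scale c hc) φ = c⁻¹ * C g φ := by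
  -- The chosen constants for `g` and `c² g` are unrelated. Therefore `C₀` is used only at the
  -- metric of gauge `1` on the ray of `g`, and the factor `g.gauge⁻¹` supplies the homogeneity.
  choose! C₀ hpos hC₀ using fun (g : AnalyticMetric d M) (φ : Fin k → M → ℝ)
    (hφ : ∀ μ, ContMDiff (𝓡∂ (d + 1)) 𝓘(ℝ, ℝ) ω (φ μ)) => exists_abs_valueAt_le g hφ
  refine ⟨fun g φ => g.gauge⁻¹ * C₀ (g.scale g.gauge⁻¹ (inv_pos.2 g.gauge_pos)) φ,
    fun g φ hφ => ⟨mul_pos (inv_pos.2 g.gauge_pos) (hpos _ φ hφ), ?_, fun c hc => ?_⟩⟩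
  · intro Z n P hZ hP hn h0 q hq
    set h := g.scale g.gauge⁻¹ (inv_pos.2 g.gauge_pos) with hh
    have hg : g = h.scale g.gauge g.gauge_pos := by
      rw [hh, g.scale_scale _ _ one_pos (mul_inv_cancel₀ g.gauge_pos.ne'), g.scale_one]
    have h1 : P.valueAt g φ q = g.gauge⁻¹ ^ n * P.valueAt h φ q := by
      conv_lhs => rw [hg]
      exact LocalFormula.valueAt_scale hP hZ hn h hφ g.gauge_pos hq
    have hg0 := inv_pos.2 g.gauge_pos
    rw [h1, abs_mul, abs_of_pos (pow_pos hg0 n), mul_pow, mul_left_comm]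
    exact mul_le_mul_of_nonneg_left (hC₀ h φ hφ Z n P hZ hP hn h0 q hq) (pow_pos hg0 n).le
  · have h1 : (g.scale c hc).gauge = c * g.gauge := g.gauge_scale hc
    have h2 : (g.scale c hc).scale (g.scale c hc).gauge⁻¹
        (inv_pos.2 (g.scale c hc).gauge_pos) = g.scale g.gauge⁻¹ (inv_pos.2 g.gauge_pos) := by
      refine g.scale_scale _ _ _ ?_
      rw [h1, mul_inv]
      field_simp
    simp only [h2]
    rw [h1, mul_inv, mul_assoc]

end ValueAt

/-! ### Suprema of compatible measures -/

/-- On `O p` every member of the family is dominated by `μ p`. A finite subcover by sets `B p` of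
finite measure therefore dominates the supremum by a finite sum of restrictions, from which both
finiteness and null sets can be read off. -/
theorem iSup_measure_univ_lt_top_and_null {M : Type*} [TopologicalSpace M] [CompactSpace M]
    [MeasurableSpace M] [BorelSpace M] (μ : M → Measure M) (O : M → Set M)
    (hμ : ∀ x p (A : Set M), MeasurableSet A → μ x (A ∩ O p) ≤ μ p (A ∩ O p))
    (hfin : ∀ p, ∃ B ∈ 𝓝 p, IsOpen B ∧ B ⊆ O p ∧ μ p B < ⊤) :
    (⨆ x, μ x) univ < ⊤ ∧ ∀ N : Set M, (∀ x, μ x N = 0) → (⨆ x, μ x) N = 0 := by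
  choose B hBn hBo hBO hBf using hfin
  obtain ⟨t, -, ht⟩ := isCompact_univ.elim_nhds_subcover B fun p _ => hBn p
  set ν : Measure M := ∑ p ∈ t, (μ p).restrict (B p) with hν
  have hle : ⨆ x, μ x ≤ ν := by
    refine iSup_le fun x => Measure.le_iff.2 fun A hA => ?_
    calc μ x A ≤ μ x (⋃ p ∈ t, A ∩ B p) := by
          refine measure_mono fun z hz => ?_
          obtain ⟨p, hp, hzp⟩ := mem_iUnion₂.1 (ht (mem_univ z))
          exact mem_iUnion₂.2 ⟨p, hp, hz, hzp⟩
      _ ≤ ∑ p ∈ t, μ x (A ∩ B p) := measure_biUnion_finset_le _ _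
      _ ≤ ∑ p ∈ t, μ p (A ∩ B p) := by
          refine Finset.sum_le_sum fun p _ => ?_
          have h1 : A ∩ B p = A ∩ B p ∩ O p :=
            (inter_eq_left.2 (inter_subset_right.trans (hBO p))).symm
          rw [h1]
          exact hμ x p _ (hA.inter (hBo p).measurableSet)
      _ = ν A := by
          rw [hν, Measure.finsetSum_apply]
          exact Finset.sum_congr rfl fun p _ => (Measure.restrict_apply hA).symm
  refine ⟨(hle univ).trans_lt ?_, fun N hN => le_antisymm ((hle N).trans (le_of_eq ?_)) zero_le⟩
  · rw [hν, Measure.finsetSum_apply]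
    refine ENNReal.sum_lt_top.2 fun p _ => ?_
    rw [Measure.restrict_apply_univ]
    exact hBf p
  · rw [hν, Measure.finsetSum_apply]
    exact Finset.sum_eq_zero fun p _ =>
      le_antisymm ((Measure.restrict_apply_le _ _).trans (hN p).le) zero_le

/-! ### Change of variables for measures pushed forward by charts. -/

theorem ContinuousOn.measurableSet_inter_preimage {X Y : Type*} [TopologicalSpace X]
    [MeasurableSpace X] [OpensMeasurableSpace X] [TopologicalSpace Y] [MeasurableSpace Y]
    [BorelSpace Y] {f : X → Y} {S : Set X} (hf : ContinuousOn f S) (hS : MeasurableSet S)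
    {D : Set Y} (hD : MeasurableSet D) : MeasurableSet (S ∩ f ⁻¹' D) := by
  have h := (continuousOn_iff_continuous_domRestrict.1 hf).measurable hD
  have h' := hS.subtype_image h
  convert h' using 1
  ext x
  simp [and_comm]

theorem MeasureTheory.Measure.map_withDensity_restrict_apply {X Y : Type*} [TopologicalSpace X]
    [MeasurableSpace X] [OpensMeasurableSpace X] [TopologicalSpace Y] [MeasurableSpace Y]
    [BorelSpace Y] {μ : Measure X} [SFinite μ] {f : X → Y} {S : Set X} (hf : ContinuousOn f S)
    (hS : MeasurableSet S) (w : X → ℝ≥0∞) {D : Set Y} (hD : MeasurableSet D) :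
    ((μ.restrict S).withDensity w).map f D = ∫⁻ z in S ∩ f ⁻¹' D, w z ∂μ := by
  have hae : AEMeasurable f ((μ.restrict S).withDensity w) :=
    (hf.aemeasurable hS).mono_ac (withDensity_absolutelyContinuous _ _)
  have hm := hf.measurableSet_inter_preimage hS hD
  rw [Measure.map_apply_of_aemeasurable hae hD, ← restrict_withDensity hS,
    Measure.restrict_apply' hS, inter_comm, withDensity_apply _ hm]

/-- The substitution `τ` turns the first integral into one over an image contained in the second
domain of integration. An inequality suffices for the supremum, so surjectivity of `τ` is never
needed. -/
theorem MeasureTheory.Measure.map_withDensity_restrict_le {F Y : Type*} [NormedAddCommGroup F]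
    [NormedSpace ℝ F] [FiniteDimensional ℝ F] [MeasurableSpace F] [BorelSpace F]
    {μ : Measure F} [μ.IsAddHaarMeasure] [TopologicalSpace Y]
    [MeasurableSpace Y] [BorelSpace Y] {a b : F → Y} {S T : Set F} {w u : F → ℝ≥0∞}
    (ha : ContinuousOn a S) (hS : MeasurableSet S) (hb : ContinuousOn b T) (hT : MeasurableSet T)
    {O : Set Y} (hO : IsOpen O) {τ : F → F} {τ' : F → F →L[ℝ] F}
    (hτ : ∀ z ∈ S ∩ a ⁻¹' O, HasFDerivWithinAt τ (τ' z) (S ∩ a ⁻¹' O) z)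
    (hinj : InjOn τ (S ∩ a ⁻¹' O)) (hmaps : MapsTo τ (S ∩ a ⁻¹' O) T)
    (hab : ∀ z ∈ S ∩ a ⁻¹' O, b (τ z) = a z)
    (hw : ∀ z ∈ S ∩ a ⁻¹' O, w z = ENNReal.ofReal |(τ' z).det| * u (τ z))
    {A : Set Y} (hA : MeasurableSet A) :
    ((μ.restrict S).withDensity w).map a (A ∩ O) ≤
      ((μ.restrict T).withDensity u).map b (A ∩ O) := by
  have hD := hA.inter hO.measurableSet
  rw [map_withDensity_restrict_apply ha hS w hD, map_withDensity_restrict_apply hb hT u hD]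
  have hm := ha.measurableSet_inter_preimage hS hD
  have hsub : S ∩ a ⁻¹' (A ∩ O) ⊆ S ∩ a ⁻¹' O := fun z hz => ⟨hz.1, hz.2.2⟩
  rw [setLIntegral_congr_fun hm fun z hz => hw z (hsub hz),
    ← lintegral_image_eq_lintegral_abs_det_fderiv_mul μ hm
      (fun z hz => (hτ z (hsub hz)).mono hsub) (hinj.mono hsub)]
  refine lintegral_mono_set ?_
  rintro _ ⟨z, hz, rfl⟩
  refine ⟨hmaps (hsub hz), ?_⟩
  rw [mem_preimage, hab z (hsub hz)]
  exact hz.2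

section Volume

variable {d : ℕ} {M : Type*} [TopologicalSpace M] [ChartedSpace (EuclideanHalfSpace (d + 1)) M]

/-! ### The boundary in charts -/

/-- The inclusion of the boundary hyperplane as a linear map. -/
noncomputable def boundaryInclL (d : ℕ) :
    EuclideanSpace ℝ (Fin d) →L[ℝ] EuclideanSpace ℝ (Fin (d + 1)) :=
  LinearMap.toContinuousLinearMap
    { toFun := boundaryIncl d
      map_add' := fun v w => by
        ext i
        refine Fin.cases ?_ (fun i => ?_) i <;> simp [boundaryIncl]
      map_smul' := fun c v => by
        ext i
        refine Fin.cases ?_ (fun i => ?_) i <;> simp [boundaryIncl] }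

/-- The projection to the boundary hyperplane. -/
noncomputable def boundaryProj (d : ℕ) :
    EuclideanSpace ℝ (Fin (d + 1)) →L[ℝ] EuclideanSpace ℝ (Fin d) :=
  LinearMap.toContinuousLinearMap
    { toFun := fun v => WithLp.toLp 2 fun i => v i.succ
      map_add' := fun _ _ => rfl
      map_smul' := fun _ _ => rfl }

theorem boundaryInclL_apply (z : EuclideanSpace ℝ (Fin d)) :
    boundaryInclL d z = boundaryIncl d z := rfl

theorem boundaryProj_apply (v : EuclideanSpace ℝ (Fin (d + 1))) (i : Fin d) :
    boundaryProj d v i = v i.succ := rfl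

theorem boundaryIncl_zero (z : EuclideanSpace ℝ (Fin d)) : boundaryIncl d z 0 = 0 := rfl

theorem boundaryIncl_succ (z : EuclideanSpace ℝ (Fin d)) (i : Fin d) :
    boundaryIncl d z i.succ = z i := rfl

theorem norm_boundaryIncl (z : EuclideanSpace ℝ (Fin d)) : ‖boundaryIncl d z‖ = ‖z‖ := by
  simp [EuclideanSpace.norm_eq, Fin.sum_univ_succ, boundaryIncl_zero, boundaryIncl_succ]

theorem boundaryIncl_boundaryProj {v : EuclideanSpace ℝ (Fin (d + 1))} (hv : v 0 = 0) :
    boundaryIncl d (boundaryProj d v) = v := by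
  ext i
  refine Fin.cases ?_ (fun i => ?_) i
  · rw [boundaryIncl_zero, hv]
  · rw [boundaryIncl_succ, boundaryProj_apply]

theorem boundaryIncl_single (i : Fin d) :
    boundaryIncl d (EuclideanSpace.single i 1) = EuclideanSpace.single i.succ 1 := by
  ext j
  refine Fin.cases ?_ (fun j => ?_) j
  · simp [boundaryIncl_zero]
  · simp [boundaryIncl_succ]

theorem continuous_boundaryIncl : Continuous (boundaryIncl d) := (boundaryInclL d).continuous

theorem continuousOn_extChartAt_symm_boundaryIncl (q : M) :
    ContinuousOn ((extChartAt (𝓡∂ (d + 1)) q).symm ∘ boundaryIncl d)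
      (boundaryIncl d ⁻¹' (extChartAt (𝓡∂ (d + 1)) q).target) :=
  (continuousOn_extChartAt_symm q).comp continuous_boundaryIncl.continuousOn fun _ hz => hz

theorem measurableSet_boundaryIncl_preimage (q : M) :
    MeasurableSet (boundaryIncl d ⁻¹' (extChartAt (𝓡∂ (d + 1)) q).target) :=
  continuous_boundaryIncl.measurable (isRelOpen_extChartAt_target q).measurableSet

/-! ### The Riemannian measures -/

/-- Near `p` both the density and the chart coordinates are bounded, and `ι` preserves norms, so the
integral runs over a part of a ball. The map `ι` is the identity for the volume and `boundaryIncl`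
for the boundary volume. -/
theorem exists_nhds_map_withDensity_lt_top [MeasurableSpace M] [BorelSpace M] {e : ℕ}
    {ι : EuclideanSpace ℝ (Fin e) → EuclideanSpace ℝ (Fin (d + 1))} (hι : Continuous ι)
    (hn : ∀ z, ‖ι z‖ = ‖z‖) (p : M) {W : EuclideanSpace ℝ (Fin (d + 1)) → ℝ}
    (hW : ContinuousOn W (extChartAt (𝓡∂ (d + 1)) p).target) :
    ∃ B ∈ 𝓝 p, IsOpen B ∧ B ⊆ (extChartAt (𝓡∂ (d + 1)) p).source ∧
      ((volume.restrict (ι ⁻¹' (extChartAt (𝓡∂ (d + 1)) p).target)).withDensity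
        fun z => ENNReal.ofReal (W (ι z))).map ((extChartAt (𝓡∂ (d + 1)) p).symm ∘ ι) B < ⊤ := by
  set φ := extChartAt (𝓡∂ (d + 1)) p with hφ
  have h1 : ContinuousOn (W ∘ φ) φ.source := hW.comp (continuousOn_extChartAt p) φ.mapsTo
  have h2 : ∀ᶠ x in 𝓝 p, x ∈ φ.source ∧ W (φ x) < W (φ p) + 1 ∧ ‖φ x‖ < ‖φ p‖ + 1 := by
    have h3 := h1.continuousAt (extChartAt_source_mem_nhds p)
    have h4 := (continuousAt_extChartAt (I := 𝓡∂ (d + 1)) p).norm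
    exact (Filter.eventually_mem_set.2 (extChartAt_source_mem_nhds (I := 𝓡∂ (d + 1)) p)).and
      ((h3.eventually (gt_mem_nhds (lt_add_one _))).and
        (h4.eventually (gt_mem_nhds (lt_add_one _))))
  obtain ⟨B, hB, hBo, hpB⟩ := eventually_nhds_iff.1 h2
  refine ⟨B, hBo.mem_nhds hpB, hBo, fun x hx => (hB x hx).1, ?_⟩
  have hS : MeasurableSet (ι ⁻¹' φ.target) :=
    hι.measurable (isRelOpen_extChartAt_target p).measurableSet
  have hc : ContinuousOn (φ.symm ∘ ι) (ι ⁻¹' φ.target) :=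
    (continuousOn_extChartAt_symm p).comp hι.continuousOn fun z hz => hz
  rw [Measure.map_withDensity_restrict_apply hc hS _ hBo.measurableSet]
  have h5 : ∀ z ∈ ι ⁻¹' φ.target ∩ φ.symm ∘ ι ⁻¹' B, W (ι z) < W (φ p) + 1 ∧
      ‖z‖ < ‖φ p‖ + 1 := by
    rintro z ⟨hz1, hz2⟩
    have := (hB _ hz2).2
    rwa [Function.comp_apply, φ.right_inv hz1, hn] at this
  refine (setLIntegral_mono' (hc.measurableSet_inter_preimage hS hBo.measurableSet)
    fun z hz => ENNReal.ofReal_le_ofReal (h5 z hz).1.le).trans_lt ?_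
  rw [setLIntegral_const]
  refine ENNReal.mul_lt_top ENNReal.ofReal_lt_top ((measure_mono (t := Metric.ball 0 (‖φ p‖ + 1))
    fun z hz => ?_).trans_lt measure_ball_lt_top)
  simpa using (h5 z hz).2

variable [IsManifold (𝓡∂ (d + 1)) ω M]

theorem continuousOn_sqrt_det_chartMetric (g : AnalyticMetric d M) (p : M) {e : ℕ}
    (f : Fin e → Fin (d + 1)) :
    ContinuousOn (fun y => Real.sqrt ((chartMetric g p y).submatrix f f).det)
      (extChartAt (𝓡∂ (d + 1)) p).target :=
  (continuous_id.matrix_submatrix f f).matrix_det.sqrt.comp_continuousOn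
    (isLocalMetric_chartMetric g p).continuousOn

theorem Matrix.sqrt_det_congr {e : ℕ} (A J : Matrix (Fin e) (Fin e) ℝ) :
    Real.sqrt (J.transpose * A * J).det = |J.det| * Real.sqrt A.det := by
  rw [Matrix.det_mul, Matrix.det_mul, Matrix.det_transpose,
    show J.det * A.det * J.det = J.det ^ 2 * A.det by ring, Real.sqrt_mul (sq_nonneg _),
    Real.sqrt_sq_eq_abs]

theorem boundary_transition (x p : M) {z : EuclideanSpace ℝ (Fin d)}
    (hz : boundaryIncl d z ∈ overlap d x p) : transition d x p (boundaryIncl d z) 0 = 0 :=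
  ((isCoordChange_transition x p).coord_eq_zero_iff hz).2 (boundaryIncl_zero z)

/-- A transition preserves the boundary, so its zeroth component vanishes identically along the
hyperplane, and with it the tangential derivatives. Hence restricting the metric to the boundary
commutes with pulling it back. -/
theorem jacobian_transition_zero_succ (x p : M) {z : EuclideanSpace ℝ (Fin d)}
    (hz : boundaryIncl d z ∈ overlap d x p) (j : Fin d) :
    jacobian (overlap d x p) (transition d x p) (boundaryIncl d z) 0 j.succ = 0 := by
  have h := isCoordChange_transition (d := d) x p
  have hopen : IsOpen (boundaryIncl d ⁻¹' overlap d x p) := by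
    obtain ⟨O, hO, hO'⟩ := isRelOpen_overlap (d := d) x p
    have h0 : boundaryIncl d ⁻¹' halfSpace d = univ :=
      eq_univ_of_forall fun z => (boundaryIncl_zero z).ge
    rw [hO', preimage_inter, h0, inter_univ]
    exact hO.preimage continuous_boundaryIncl
  have h1 := (h.contDiffOn.differentiableOn (by simp) _ hz).hasFDerivWithinAt
  have h2 : HasFDerivWithinAt (boundaryIncl d) (boundaryInclL d)
      (boundaryIncl d ⁻¹' overlap d x p) z := (boundaryInclL d).hasFDerivWithinAt
  have h3 := (EuclideanSpace.proj (𝕜 := ℝ) (0 : Fin (d + 1))).hasFDerivAt.comp_hasFDerivWithinAt z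
    (h1.comp z h2 fun y hy => hy)
  have h4 := h3.congr (f₁ := fun _ => (0 : ℝ)) (fun y hy => (boundary_transition x p hy).symm)
    (boundary_transition x p hz).symm
  have h5 := (hopen.uniqueDiffWithinAt hz).eq h4 (hasFDerivWithinAt_const _ _ _)
  have h6 := congrArg (fun T : EuclideanSpace ℝ (Fin d) →L[ℝ] ℝ =>
    T (EuclideanSpace.single j 1)) h5
  rw [jacobian, Matrix.of_apply, ← boundaryIncl_single]
  exact h6

theorem Matrix.submatrix_succ_conj (A J : Matrix (Fin (d + 1)) (Fin (d + 1)) ℝ)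
    (h : ∀ j : Fin d, J 0 j.succ = 0) :
    (J.transpose * A * J).submatrix Fin.succ Fin.succ =
      (J.submatrix Fin.succ Fin.succ).transpose * A.submatrix Fin.succ Fin.succ *
        J.submatrix Fin.succ Fin.succ := by
  ext i j
  simp [Matrix.mul_apply, Fin.sum_univ_succ, h]

variable [MeasurableSpace M] [BorelSpace M]

theorem chartVolume_inter_le (g : AnalyticMetric d M) (x p : M) {A : Set M}
    (hA : MeasurableSet A) :
    chartVolume g x (A ∩ (extChartAt (𝓡∂ (d + 1)) p).source) ≤
      chartVolume g p (A ∩ (extChartAt (𝓡∂ (d + 1)) p).source) := by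
  have h := isCoordChange_transition (d := d) x p
  refine Measure.map_withDensity_restrict_le (continuousOn_extChartAt_symm x)
    (isRelOpen_extChartAt_target x).measurableSet (continuousOn_extChartAt_symm p)
    (isRelOpen_extChartAt_target p).measurableSet (isOpen_extChartAt_source p)
    (τ := transition d x p) (τ' := fderivWithin ℝ (transition d x p) (overlap d x p))
    (fun z hz => (h.contDiffOn.differentiableOn (by simp) z hz).hasFDerivWithinAt)
    h.leftInv.injOn (fun z hz => (h.mapsTo hz).1)
    (fun z hz => extChartAt_symm_transition hz) (fun z hz => ?_) hA
  rw [chartMetric_eq_pullback g hz, pullbackMetric_eq, Matrix.sqrt_det_congr, det_jacobian,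
    ENNReal.ofReal_mul (abs_nonneg _)]

theorem riemannianVolume_lt_top [CompactSpace M] (g : AnalyticMetric d M) :
    riemannianVolume g univ < ⊤ := by
  refine (iSup_measure_univ_lt_top_and_null (chartVolume g)
    (fun p => (extChartAt (𝓡∂ (d + 1)) p).source)
    (fun x p A hA => chartVolume_inter_le g x p hA) fun p => ?_).1
  have hW := continuousOn_sqrt_det_chartMetric g p id
  simp only [Matrix.submatrix_id_id] at hW
  obtain ⟨B, hB, hBo, hBs, hlt⟩ :=
    exists_nhds_map_withDensity_lt_top (ι := id) continuous_id (fun z => rfl) p hW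
  refine ⟨B, hB, hBo, hBs, ?_⟩
  rw [chartVolume]
  simpa only [preimage_id, Function.comp_id, id] using hlt

theorem chartBoundaryVolume_inter_le (g : AnalyticMetric d M) (x p : M) {A : Set M}
    (hA : MeasurableSet A) :
    chartBoundaryVolume g x (A ∩ (extChartAt (𝓡∂ (d + 1)) p).source) ≤
      chartBoundaryVolume g p (A ∩ (extChartAt (𝓡∂ (d + 1)) p).source) := by
  have h := isCoordChange_transition (d := d) x p
  have hτ : ∀ z ∈ boundaryIncl d ⁻¹' overlap d x p,
      boundaryIncl d (boundaryProj d (transition d x p (boundaryIncl d z))) =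
        transition d x p (boundaryIncl d z) := fun z hz =>
    boundaryIncl_boundaryProj (boundary_transition x p hz)
  refine Measure.map_withDensity_restrict_le
    (continuousOn_extChartAt_symm_boundaryIncl x) (measurableSet_boundaryIncl_preimage x)
    (continuousOn_extChartAt_symm_boundaryIncl p) (measurableSet_boundaryIncl_preimage p)
    (isOpen_extChartAt_source p)
    (τ := fun z => boundaryProj d (transition d x p (boundaryIncl d z)))
    (τ' := fun z => (boundaryProj d).comp ((fderivWithin ℝ (transition d x p) (overlap d x p)
      (boundaryIncl d z)).comp (boundaryInclL d)))
    (fun z hz => ?_) (fun z hz w hw hzw => ?_) (fun z hz => ?_) (fun z hz => ?_)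
    (fun z hz => ?_) hA
  · have h1 := (h.contDiffOn.differentiableOn (by simp) _ hz).hasFDerivWithinAt
    have h2 : HasFDerivWithinAt (boundaryIncl d) (boundaryInclL d)
        (boundaryIncl d ⁻¹' overlap d x p) z := (boundaryInclL d).hasFDerivWithinAt
    exact (boundaryProj d).hasFDerivAt.comp_hasFDerivWithinAt z (h1.comp z h2 fun y hy => hy)
  · have h1 := congrArg (boundaryIncl d) hzw
    simp only [hτ z hz, hτ w hw] at h1
    exact congrArg (boundaryProj d) (h.leftInv.injOn hz hw h1)
  · rw [mem_preimage, hτ z hz]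
    exact (h.mapsTo hz).1
  · rw [Function.comp_apply, hτ z hz]
    exact extChartAt_symm_transition hz
  · have hdet : ((jacobian (overlap d x p) (transition d x p) (boundaryIncl d z)).submatrix
        Fin.succ Fin.succ).det = ((boundaryProj d).comp ((fderivWithin ℝ (transition d x p)
          (overlap d x p) (boundaryIncl d z)).comp (boundaryInclL d))).det := by
      rw [ContinuousLinearMap.det,
        ← LinearMap.det_toMatrix (EuclideanSpace.basisFun (Fin d) ℝ).toBasis]
      congr 1
      ext a i
      simp [jacobian, LinearMap.toMatrix_apply, boundaryInclL_apply, boundaryIncl_single,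
        boundaryProj_apply]
    rw [hτ z hz, chartMetric_eq_pullback g hz, pullbackMetric_eq,
      Matrix.submatrix_succ_conj _ _ (jacobian_transition_zero_succ x p hz),
      Matrix.sqrt_det_congr, hdet, ENNReal.ofReal_mul (abs_nonneg _)]

theorem chartBoundaryVolume_compl_boundary (g : AnalyticMetric d M) (x : M) :
    chartBoundaryVolume g x
      (stratumIn M {y : EuclideanSpace ℝ (Fin (d + 1)) | y 0 = 0})ᶜ = 0 := by
  have hZ : IsStratum {y : EuclideanSpace ℝ (Fin (d + 1)) | y 0 = 0} := Or.inr rfl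
  rw [chartBoundaryVolume, Measure.map_withDensity_restrict_apply
    (continuousOn_extChartAt_symm_boundaryIncl x) (measurableSet_boundaryIncl_preimage x) _
    hZ.isClosed_stratumIn.measurableSet.compl]
  have : boundaryIncl d ⁻¹' (extChartAt (𝓡∂ (d + 1)) x).target ∩
      ((extChartAt (𝓡∂ (d + 1)) x).symm ∘ boundaryIncl d) ⁻¹'
        (stratumIn M {y : EuclideanSpace ℝ (Fin (d + 1)) | y 0 = 0})ᶜ = ∅ := by
    refine eq_empty_of_forall_notMem fun z hz => hz.2 ?_
    rw [Function.comp_apply, hZ.mem_stratumIn_iff ((extChartAt (𝓡∂ (d + 1)) x).map_target hz.1),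
      (extChartAt (𝓡∂ (d + 1)) x).right_inv hz.1]
    exact boundaryIncl_zero z
  rw [this, Measure.restrict_empty, lintegral_zero_measure]

theorem riemannianBoundaryVolume_lt_top [CompactSpace M] (g : AnalyticMetric d M) :
    riemannianBoundaryVolume g univ < ⊤ ∧
      riemannianBoundaryVolume g
        (stratumIn M {y : EuclideanSpace ℝ (Fin (d + 1)) | y 0 = 0})ᶜ = 0 := by
  have hfin : ∀ p : M, ∃ B ∈ 𝓝 p, IsOpen B ∧ B ⊆ (extChartAt (𝓡∂ (d + 1)) p).source ∧
      chartBoundaryVolume g p B < ⊤ := by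
    intro p
    obtain ⟨B, hB, hBo, hBs, hlt⟩ := exists_nhds_map_withDensity_lt_top continuous_boundaryIncl
      norm_boundaryIncl p (continuousOn_sqrt_det_chartMetric g p Fin.succ)
    refine ⟨B, hB, hBo, hBs, ?_⟩
    rw [chartBoundaryVolume]
    exact hlt
  have h := iSup_measure_univ_lt_top_and_null (chartBoundaryVolume g)
    (fun p => (extChartAt (𝓡∂ (d + 1)) p).source)
    (fun x p A hA => chartBoundaryVolume_inter_le g x p hA) hfin
  exact ⟨h.1, h.2 _ (chartBoundaryVolume_compl_boundary g)⟩

end Volume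

/-! ### Integration of the pointwise estimates. -/

/-- Continuity and bounds are required only on a closed set of full measure, since away from `∂M`
nothing is known about the values of a boundary invariant. -/
theorem integrable_and_abs_integral_le {X : Type*} [TopologicalSpace X] [CompactSpace X]
    [MeasurableSpace X] [BorelSpace X] {μ : Measure X} (hμ : μ univ < ⊤) {S : Set X}
    (hS : IsClosed S) (hμS : μ Sᶜ = 0) {f : X → ℝ} (hf : ContinuousOn f S) :
    Integrable f μ ∧ ∀ C : ℝ, (∀ x ∈ S, |f x| ≤ C) → |∫ x, f x ∂μ| ≤ C * μ.real univ := by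
  have : IsFiniteMeasure μ := ⟨hμ⟩
  have hr : μ.restrict S = μ := Measure.restrict_eq_self_of_ae_mem (mem_ae_iff.2 hμS)
  refine ⟨?_, fun C hC => ?_⟩
  · obtain ⟨C, hC⟩ := hS.isCompact.exists_bound_of_continuousOn hf
    have h1 := hf.aestronglyMeasurable (μ := μ) hS.measurableSet
    rw [hr] at h1
    refine Integrable.of_bound h1 C ?_
    filter_upwards [mem_ae_iff.2 hμS] with x hx using hC x hx
  · refine norm_integral_le_of_norm_le_const (f := f) ?_
    filter_upwards [mem_ae_iff.2 hμS] with x hx using hC x hx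

theorem theorem2p1 (d k : ℕ) :
    ∃ (κE : ∀ n : ℕ, InteriorInvariant (d + 1) k n → ℝ)
      (κF : ∀ p : ℕ, BoundaryInvariant (d + 1) k p → ℝ),
      (∀ n E, 0 < κE n E) ∧ (∀ p F, 0 < κF p F) ∧
      ∀ (M : Type*) [TopologicalSpace M] [T2Space M] [CompactSpace M] [Nonempty M]
        [ChartedSpace (EuclideanHalfSpace (d + 1)) M] [IsManifold (𝓡∂ (d + 1)) ω M]
        [MeasurableSpace M] [BorelSpace M],
        ∃ C : AnalyticMetric d M → (Fin k → M → ℝ) → ℝ,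
          ∀ (g : AnalyticMetric d M) (φ : Fin k → M → ℝ),
            (∀ μ, ContMDiff (𝓡∂ (d + 1)) 𝓘(ℝ, ℝ) ω (φ μ)) →
            0 < C g φ ∧
            riemannianVolume g univ < ⊤ ∧
            riemannianBoundaryVolume g univ < ⊤ ∧
            (∀ (n : ℕ) (E : InteriorInvariant (d + 1) k n),
              Integrable (E.formula.valueAt g φ) (riemannianVolume g) ∧
              ((n ≠ 0 ∨ ∀ μ x, |φ μ x| ≤ 1) →
                |∫ x, E.formula.valueAt g φ x ∂(riemannianVolume g)| ≤
                  κE n E * C g φ ^ n * (riemannianVolume g).real univ)) ∧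
            (∀ (p : ℕ) (F : BoundaryInvariant (d + 1) k p),
              Integrable (F.formula.valueAt g φ) (riemannianBoundaryVolume g) ∧
              ((p ≠ 0 ∨ ∀ μ x, |φ μ x| ≤ 1) →
                |∫ y, F.formula.valueAt g φ y ∂(riemannianBoundaryVolume g)| ≤
                  κF p F * C g φ ^ p * (riemannianBoundaryVolume g).real univ)) ∧
            ∀ (c : ℝ) (hc : 0 < c), C (g.scale c hc) φ = c⁻¹ * C g φ := by
  refine ⟨fun n E => E.formula.kappa, fun p F => F.formula.kappa,
    fun n E => E.formula.kappa_pos, fun p F => F.formula.kappa_pos, ?_⟩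
  intro M _ _ _ _ _ _ _ _
  obtain ⟨C, hC⟩ := exists_homogeneous_bound d k M
  refine ⟨C, fun g φ hφ => ?_⟩
  obtain ⟨hpos, hbound, hscale⟩ := hC g φ hφ
  have hv := riemannianVolume_lt_top g
  obtain ⟨hb, hb0⟩ := riemannianBoundaryVolume_lt_top g
  refine ⟨hpos, hv, hb, fun n E => ?_, fun p F => ?_, hscale⟩
  · have hZ : IsStratum (univ : Set (EuclideanSpace ℝ (Fin (d + 1)))) := Or.inl rfl
    -- The charts of `M` take values in the half-space, so invariance on open sets of the full space
    -- does not suffice as it stands.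
    have hP := LocalFormula.isInvariant_halfSpace E.invariant E.continuousOn_coeff
    have h := integrable_and_abs_integral_le hv (hZ.isClosed_stratumIn (M := M))
      (by simp [stratumIn]) (LocalFormula.continuousOn_valueAt hP E.continuousOn_coeff g hφ)
    exact ⟨h.1, fun h0 => h.2 _ (hbound _ n _ hZ hP E.homogeneous h0)⟩
  · have hZ : IsStratum {y : EuclideanSpace ℝ (Fin (d + 1)) | y 0 = 0} := Or.inr rfl
    have hP : F.formula.IsInvariant (halfSpace d) {y | y 0 = 0} := F.invariant
    have h := integrable_and_abs_integral_le hb (hZ.isClosed_stratumIn (M := M))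
      hb0 (LocalFormula.continuousOn_valueAt hP F.continuousOn_coeff g hφ)
    exact ⟨h.1, fun h0 => h.2 _ (hbound _ p _ hZ hP F.homogeneous h0)⟩
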